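/- Let $k \ge 0$. Every decision problem in $\mathrm{EXPTIME}_k$ is accepted by a (possibly non-deterministic) cons-free program of data order $k$ with unary variables. Here a decision problem is a set $A \subseteq \{0,1\}^+$, and $\mathrm{EXPTIME}_k$ consists of the decision problems that a deterministic Turing machine decides in at most $\exp_2^k(a\cdot n^b)$ steps on inputs of length $n$, for some $a,b$, where $\exp_2^0(m)=m$ and $\exp_2^{k+1}(m)=2^{\exp_2^k(m)}$. Types are built from sorts by $\times$ and $\Rightarrow$; the order of a sort is $0$, $\mathrm{ord}(\sigma\times\tau)=\max(\mathrm{ord}(\sigma),\mathrm{ord}(\tau))$ and $\mathrm{ord}(\sigma\Rightarrow\tau)=\max(\mathrm{ord}(\sigma)+1,\mathrm{ord}(\tau))$. A program consists of finitely many typed constructors $c:\iota_1\Rightarrow\dots\Rightarrow\iota_m\Rightarrow\kappa$ (each $\iota_i$ of order $0$, $\kappa$ a sort; constructors are always fully applied), finitely many typed defined symbols, and a finite set of rules $f\,\ell_1\cdots\ell_n\to r$ between terms of equal type, where no defined symbol occurs in any $\ell_i$, no variable occurs twice on the left, every variable of $r$ occurs on the left, and all rules for the same $f$ have the same number $n$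 of arguments (the arity of $f$). Programs are evaluated by non-deterministic call-by-value reduction $\to^*$: all arguments are reduced to values (data terms, i.e. ground constructor terms; pairs of values; defined symbols applied to fewer values than their arity) before any matching rule is applied. A program is cons-free if every subterm of the form $c\,s_1\cdots s_m$ ($c$ a constructor) of the right-hand side of a rule is a data term or a strict subterm of the left-hand side of that rule. It has unary variables if every variable occurring in a rule has a type $\iota$ or $\sigma\Rightarrow\iota$ with $\mathrm{ord}(\iota)=0$. Its data order is the largest type order of an argument of a defined symbol or of a variable occurring in a rule. A program with constructors $\mathsf{true},\mathsf{false}:\mathsf{bool}$, $[\,]:\mathsf{list}$, ${::}:\mathsf{bool}\Rightarrow\mathsf{list}\Rightarrow\mathsf{list}$ and a defined symbol $\mathsf{start}:\mathsf{list}\Rightarrow\mathsf{bool}$ accepts $A$ if for all $x_1\dots x_n\in\{0,1\}^+$: $x_1\dots x_n\in A$ if and only if $\mathsf{start}\,(\overline{x_1}::\cdots::\overline{x_n}::[\,])\to^*\mathsf{true}$, where $\overline{1}=\mathsf{true}$ and $\overline{0}=\mathsf{false}$. -/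

import Mathlib

namespace ConsFree

/-! ### Types, signatures, terms -/

/-- Simple types with products over a set `B` of sorts. -/
inductive Ty (B : Type) : Type
  | sort (b : B) : Ty B
  | prod (σ τ : Ty B) : Ty B
  | arrow (σ τ : Ty B) : Ty B

/-- The type order. -/
def Ty.order {B : Type} : Ty B → ℕ
  | .sort _ => 0
  | .prod σ τ => max σ.order τ.order
  | .arrow σ τ => max (σ.order + 1) τ.order

/-- `arrows [σ₁, …, σₙ] τ` is `σ₁ ⇒ … ⇒ σₙ ⇒ τ`. -/
def Ty.arrows {B : Type} : List (Ty B) → Ty B → Ty B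
  | [], τ => τ
  | σ :: σs, τ => .arrow σ (Ty.arrows σs τ)

/-- All argument types of a type: `[σ₁, …, σₙ]` for `σ₁ ⇒ … ⇒ σₙ ⇒ τ` with `τ` not an arrow. -/
def Ty.args {B : Type} : Ty B → List (Ty B)
  | .sort _ => []
  | .prod _ _ => []
  | .arrow σ τ => σ :: τ.args

/-- Sorts, finitely many constructors and finitely many defined symbols, with their types.
The constructor `c` has type `ι₁ ⇒ … ⇒ ιₘ ⇒ κ` with `conArgs c = [ι₁, …, ιₘ]`, all of order `0`,
and `conSort c = κ`. -/
structure Signature where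
  Srt : Type
  Con : Type
  Def : Type
  [conFintype : Fintype Con]
  [defFintype : Fintype Def]
  conArgs : Con → List (Ty Srt)
  conSort : Con → Srt
  conArgs_order : ∀ c, ∀ ι ∈ conArgs c, ι.order = 0
  defTy : Def → Ty Srt

attribute [instance] Signature.conFintype Signature.defFintype

/-- Variables: countably many for each type. -/
structure Var (S : Signature) : Type where
  name : ℕ
  ty : Ty S.Srt

/-- The symbols that can stand at the head of an application. -/
inductive Head (S : Signature) : Type
  | con (c : S.Con) : Head S
  | fn (f : S.Def) : Head S
  | var (x : Var S) : Head S

/-- Raw terms `a s₁ … sₙ` and `(s, t)`; the terms proper are those that have a type. -/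
inductive Term (S : Signature) : Type
  | app (h : Head S) (args : List (Term S)) : Term S
  | pair (s t : Term S) : Term S

variable {S : Signature}

/-- The typing relation. Constructors are fully applied; variables and defined symbols
can be partially applied. -/
inductive HasType : Term S → Ty S.Srt → Prop
  | con (c : S.Con) (args : List (Term S))
      (hlen : args.length = (S.conArgs c).length)
      (hargs : ∀ p ∈ args.zip (S.conArgs c), HasType p.1 p.2) :
      HasType (.app (.con c) args) (.sort (S.conSort c))
  | fn (f : S.Def) (args : List (Term S)) (σs : List (Ty S.Srt)) (τ : Ty S.Srt)
      (hf : S.defTy f = Ty.arrows σs τ)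
      (hlen : args.length = σs.length)
      (hargs : ∀ p ∈ args.zip σs, HasType p.1 p.2) :
      HasType (.app (.fn f) args) τ
  | var (x : Var S) (args : List (Term S)) (σs : List (Ty S.Srt)) (τ : Ty S.Srt)
      (hx : x.ty = Ty.arrows σs τ)
      (hlen : args.length = σs.length)
      (hargs : ∀ p ∈ args.zip σs, HasType p.1 p.2) :
      HasType (.app (.var x) args) τ
  | pair (s t : Term S) (σ τ : Ty S.Srt) (hs : HasType s σ) (ht : HasType t τ) :
      HasType (.pair s t) (.prod σ τ)

def Head.vars : Head S → List (Var S)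
  | .con _ => []
  | .fn _ => []
  | .var x => [x]

mutual
/-- The list of occurrences of variables in a term (with repetitions, heads included). -/
def Term.vars : Term S → List (Var S)
  | .app h args => h.vars ++ varsList args
  | .pair s t => s.vars ++ t.vars
def varsList : List (Term S) → List (Var S)
  | [] => []
  | t :: ts => t.vars ++ varsList ts
end

def Term.Ground (t : Term S) : Prop := t.vars = []

/-- `Subterm t s`: `t` is a (not necessarily strict) subterm of `s`. The head of an
application, partially applied or not, is not a subterm of it. -/
inductive Subterm (t : Term S) : Term S → Prop
  | refl : Subterm t t
  | app (h : Head S) (args : List (Term S)) (u : Term S) (hu : u ∈ args)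
      (ht : Subterm t u) : Subterm t (.app h args)
  | left (u v : Term S) (ht : Subterm t u) : Subterm t (.pair u v)
  | right (u v : Term S) (ht : Subterm t v) : Subterm t (.pair u v)

/-- The application `t v₁ … vₙ`. (A pair is never applied in a typed term.) -/
def Term.applyTo : Term S → List (Term S) → Term S
  | .app h args, vs => .app h (args ++ vs)
  | .pair s t, _ => .pair s t

mutual
/-- `s.subst γ` replaces each variable `x` in `s` by `γ x`. -/
def Term.subst (γ : Var S → Term S) : Term S → Term S
  | .app (.con c) args => .app (.con c) (substList γ args)
  | .app (.fn f) args => .app (.fn f) (substList γ args)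
  | .app (.var x) args => (γ x).applyTo (substList γ args)
  | .pair s t => .pair (s.subst γ) (t.subst γ)
def substList (γ : Var S → Term S) : List (Term S) → List (Term S)
  | [] => []
  | t :: ts => t.subst γ :: substList γ ts
end

/-- Data terms: the ground constructor terms. -/
inductive IsData : Term S → Prop
  | con (c : S.Con) (args : List (Term S))
      (hty : HasType (.app (.con c) args) (.sort (S.conSort c)))
      (hargs : ∀ t ∈ args, IsData t) : IsData (.app (.con c) args)
  | pair (s t : Term S) (hs : IsData s) (ht : IsData t) : IsData (.pair s t)

/-! ### Rules and programs -/

/-- The pair `fn args → rhs`. -/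
structure Rule (S : Signature) where
  fn : S.Def
  args : List (Term S)
  rhs : Term S

def Rule.lhs (ρ : Rule S) : Term S := .app (.fn ρ.fn) ρ.args

/-- The conditions on the two sides of a rule. -/
structure Rule.WellFormed (ρ : Rule S) : Prop where
  no_defined : ∀ l ∈ ρ.args, ∀ (f : S.Def) (ts : List (Term S)), ¬ Subterm (.app (.fn f) ts) l
  linear : ρ.lhs.vars.Nodup
  vars_subset : ∀ x ∈ ρ.rhs.vars, x ∈ ρ.lhs.vars
  typed : ∃ τ, HasType ρ.lhs τ ∧ HasType ρ.rhs τ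

/-- A program: a signature and a finite consistent set of rules. -/
structure Program where
  sig : Signature
  rules : List (Rule sig)
  wellFormed : ∀ ρ ∈ rules, ρ.WellFormed
  consistent : ∀ ρ ∈ rules, ∀ ρ' ∈ rules, ρ.fn = ρ'.fn → ρ.args.length = ρ'.args.length

/-- `n < arity f`, the arity of `f` being the number of arguments in the rules for `f`. -/
def Program.BelowArity (P : Program) (n : ℕ) (f : P.sig.Def) : Prop :=
  ∃ ρ ∈ P.rules, ρ.fn = f ∧ n < ρ.args.length

inductive Program.IsValue (P : Program) : Term P.sig → Prop
  | data (t : Term P.sig) (ht : IsData t) : P.IsValue t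
  | pair (v w : Term P.sig) (hv : P.IsValue v) (hw : P.IsValue w) : P.IsValue (.pair v w)
  | partialApp (f : P.sig.Def) (vs : List (Term P.sig)) (hlt : P.BelowArity vs.length f)
      (hvs : ∀ v ∈ vs, P.IsValue v) (hty : ∃ τ, HasType (.app (.fn f) vs) τ) :
      P.IsValue (.app (.fn f) vs)

/-- `γ` maps the variables in `X` to ground terms of the same type. -/
def IsSubstOn (γ : Var S → Term S) (X : List (Var S)) : Prop :=
  ∀ x ∈ X, (γ x).Ground ∧ HasType (γ x) x.ty

/-- The call-by-value reduction relation `s →* w`. -/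
inductive Program.Eval (P : Program) : Term P.sig → Term P.sig → Prop
  | pair (s t v w : Term P.sig) (hs : P.Eval s v) (ht : P.Eval t w) :
      P.Eval (.pair s t) (.pair v w)
  | con (c : P.sig.Con) (ss vs : List (Term P.sig)) (hlen : ss.length = vs.length)
      (hev : ∀ p ∈ ss.zip vs, P.Eval p.1 p.2) :
      P.Eval (.app (.con c) ss) (.app (.con c) vs)
  | partialApp (f : P.sig.Def) (ss vs : List (Term P.sig)) (hlen : ss.length = vs.length)
      (hlt : P.BelowArity ss.length f)
      (hev : ∀ p ∈ ss.zip vs, P.Eval p.1 p.2) :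
      P.Eval (.app (.fn f) ss) (.app (.fn f) vs)
  | rule (f : P.sig.Def) (ss vs : List (Term P.sig)) (hlen : ss.length = vs.length)
      (hev : ∀ p ∈ ss.zip vs, P.Eval p.1 p.2)
      (hval : ∀ v ∈ vs, P.IsValue v)
      (ρ : Rule P.sig) (hρ : ρ ∈ P.rules) (hf : ρ.fn = f)
      (hle : ρ.args.length ≤ ss.length)
      (γ : Var P.sig → Term P.sig) (hγ : IsSubstOn γ ρ.lhs.vars)
      (hmatch : vs.take ρ.args.length = ρ.args.map (Term.subst γ))
      (w : Term P.sig)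
      (hw : P.Eval ((ρ.rhs.subst γ).applyTo (vs.drop ρ.args.length)) w) :
      P.Eval (.app (.fn f) ss) w

/-- Every constructor-headed subterm of the right-hand side is a data term or a strict
subterm of the left-hand side. -/
def Rule.IsConsFree (ρ : Rule S) : Prop :=
  ∀ (c : S.Con) (ts : List (Term S)), Subterm (.app (.con c) ts) ρ.rhs →
    IsData (.app (.con c) ts) ∨
      (Subterm (.app (.con c) ts) ρ.lhs ∧ Term.app (.con c) ts ≠ ρ.lhs)

def Program.IsConsFree (P : Program) : Prop := ∀ ρ ∈ P.rules, ρ.IsConsFree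

/-- All variables occurring in rules have a type `ι` or `σ ⇒ ι` with `ι` of order `0`. -/
def Program.UnaryVariables (P : Program) : Prop :=
  ∀ ρ ∈ P.rules, ∀ x ∈ ρ.lhs.vars ++ ρ.rhs.vars,
    x.ty.order = 0 ∨ ∃ σ ι : Ty P.sig.Srt, ι.order = 0 ∧ x.ty = .arrow σ ι

/-- The largest order of a type in a list (`0` for the empty list). -/
def maxOrder {B : Type} (σs : List (Ty B)) : ℕ := (σs.map Ty.order).foldr max 0

/-- The data order of a program: the largest type order of an argument of a defined symbol or
of a variable occurring in a rule. -/
def Program.dataOrder (P : Program) : ℕ :=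
  max (Finset.univ.sup fun f : P.sig.Def => maxOrder (P.sig.defTy f).args)
    (maxOrder (P.rules.flatMap fun ρ => (ρ.lhs.vars ++ ρ.rhs.vars).map Var.ty))

/-! ### Decision problems -/

/-- Nonempty words over `{0, 1}`, with `true` for `1`. -/
abbrev Word : Type := {x : List Bool // x ≠ []}

/-- The symbols through which a program receives its input and gives its answer. -/
structure Program.Interface (P : Program) where
  boolSort : P.sig.Srt
  listSort : P.sig.Srt
  sorts_ne : boolSort ≠ listSort
  tt : P.sig.Con
  ff : P.sig.Con
  tt_ne_ff : tt ≠ ff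
  nil : P.sig.Con
  cons : P.sig.Con
  start : P.sig.Def
  tt_ty : P.sig.conArgs tt = [] ∧ P.sig.conSort tt = boolSort
  ff_ty : P.sig.conArgs ff = [] ∧ P.sig.conSort ff = boolSort
  nil_ty : P.sig.conArgs nil = [] ∧ P.sig.conSort nil = listSort
  cons_ty : P.sig.conArgs cons = [.sort boolSort, .sort listSort] ∧
    P.sig.conSort cons = listSort
  start_ty : P.sig.defTy start = .arrow (.sort listSort) (.sort boolSort)

def Program.Interface.bit {P : Program} (I : P.Interface) : Bool → Term P.sig
  | true => .app (.con I.tt) []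
  | false => .app (.con I.ff) []

def Program.Interface.encode {P : Program} (I : P.Interface) : List Bool → Term P.sig
  | [] => .app (.con I.nil) []
  | b :: bs => .app (.con I.cons) [I.bit b, I.encode bs]

/-- The program accepts `A`: `start` applied to the encoding of `x` can be reduced to `true`
if and only if `x ∈ A`. -/
def Program.Accepts (P : Program) (A : Set Word) : Prop :=
  ∃ I : P.Interface, ∀ x : Word,
    x ∈ A ↔ P.Eval (.app (.fn I.start) [I.encode x.1]) (I.bit true)

/-! ### Turing machines -/

inductive Move : Type
  | left
  | stay
  | right

/-- Deterministic machines with a single tape that is infinite to the right. -/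
structure TM where
  Q : Type
  Γ : Type
  [finQ : Finite Q]
  [finΓ : Finite Γ]
  start : Q
  accept : Q
  reject : Q
  accept_ne_reject : accept ≠ reject
  blank : Γ
  bit : Bool → Γ
  bit_injective : Function.Injective bit
  bit_ne_blank : ∀ b, bit b ≠ blank
  δ : Q → Γ → Q × Γ × Move

structure TM.Cfg (M : TM) where
  state : M.Q
  head : ℕ
  tape : ℕ → M.Γ

/-- The new head position; a move to the left on the leftmost cell has no effect. -/
def Move.apply : Move → ℕ → ℕ
  | .left, p => p - 1
  | .stay, p => p
  | .right, p => p + 1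

open Classical in
/-- One step; a configuration in the accepting or the rejecting state is final. -/
noncomputable def TM.step (M : TM) (c : M.Cfg) : M.Cfg :=
  if c.state = M.accept ∨ c.state = M.reject then c
  else
    let a := M.δ c.state (c.tape c.head)
    { state := a.1
      head := a.2.2.apply c.head
      tape := Function.update c.tape c.head a.2.1 }

/-- The start configuration: a blank, the input, then blanks, with the head on cell `0`. -/
def TM.init (M : TM) (x : List Bool) : M.Cfg where
  state := M.start
  head := 0
  tape
    | 0 => M.blank
    | i + 1 => (x[i]?).elim M.blank M.bit

/-- `M` decides `A` in time `T`: on each input `x` it halts after at most `T |x|` steps, in the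
accepting state if `x ∈ A` and in the rejecting state otherwise. -/
def TM.DecidesInTime (M : TM) (A : Set Word) (T : ℕ → ℕ) : Prop :=
  ∀ x : Word, ∃ t ≤ T x.1.length,
    (x ∈ A → (M.step^[t] (M.init x.1)).state = M.accept) ∧
    (x ∉ A → (M.step^[t] (M.init x.1)).state = M.reject)

/-- `exp2 k m` is a tower of `k` twos with `m` on top. -/
def exp2 : ℕ → ℕ → ℕ
  | 0, m => m
  | k + 1, m => 2 ^ exp2 k m

/-- The class `EXPTIME_k`. -/
def EXPTIME (k : ℕ) : Set (Set Word) :=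
  {A | ∃ (M : TM) (T : ℕ → ℕ) (a b : ℕ),
    M.DecidesInTime A T ∧ ∀ n, T n ≤ exp2 k (a * n ^ b)}

end ConsFree

/-!
A deterministic program suffices. It computes the entries of the space-time diagram of a Turing
machine, by recursion on time, and all the order it needs is the order of its counters.

*Counters.* A tuple of `d` suffixes of an input of length `n` stands for a number below
`(n + 1) ^ d`; pairs are not constructors, so that such tuples can be formed in a cons-free program.
If the values of type `σ` count to `N`, those of type `σ ⇒ bool` count to `2 ^ N` in binary. After
`k` such steps the counters have a unary type of order `k` and range over `exp2 k ((n + 1) ^ d)`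
numbers. The largest counter, the test for zero and the predecessor are programmed level by level
(`counterSpec`); for a functional type the predecessor of `F` is again a partial application, which
negates bit `i` of `F` if no lower bit is set (`testBit_pred`).

*Simulation.* The machine is turned into a cellular automaton, whose cells hold a tape symbol and
possibly the state. Cell `u` of row `t` describes the position `u - t - 1`, so that it depends on
the cells `u - 2`, `u - 1`, `u` of row `t - 1`, and predecessors are the only arithmetic that is
needed. A cell in which the machine accepts infects its neighbours, hence the last cell of the
diagonal gives the answer as soon as the range of the counters is more than twice the running time
(`TM.acc_grid_iff`).

*Correctness.* `Res P t Φ` says that `t` has a result and that all its results are values satisfying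
`Φ`. It is established compositionally: `Res.call` evaluates arguments, and `Res.step` applies the
only rule that matches. That `start` has a result and that all its results are the expected truth
value (`res_start`) is acceptance in both directions.
-/

namespace ConsFree

/-! ### Values and results of terms -/

section Results

variable {S : Signature}

@[simp] theorem Term.applyTo_nil (t : Term S) : t.applyTo [] = t := by
  cases t <;> simp [Term.applyTo]

theorem varsList_eq_nil {ts : List (Term S)} (h : ∀ t ∈ ts, t.vars = []) : varsList ts = [] := by
  induction ts with
  | nil => rfl
  | cons t ts ih =>
    simp only [List.mem_cons, forall_eq_or_imp] at h
    simp [varsList, h.1, ih h.2]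

theorem IsData.ground {t : Term S} (h : IsData t) : t.Ground := by
  unfold Term.Ground
  induction h with
  | con c args _ _ ih => simp [Term.vars, Head.vars, varsList_eq_nil ih]
  | pair s t _ _ ihs iht => simp [Term.vars, ihs, iht]

variable {P : Program}

theorem Program.IsValue.ground {t : Term P.sig} (h : P.IsValue t) : t.Ground := by
  unfold Term.Ground
  induction h with
  | data t ht => exact ht.ground
  | pair s t _ _ ihs iht => simp [Term.vars, ihs, iht]
  | partialApp f vs _ _ _ ih => simp [Term.vars, Head.vars, varsList_eq_nil ih]

theorem Program.BelowArity.lt {n : ℕ} {f : P.sig.Def} (h : P.BelowArity n f)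
    {ρ : Rule P.sig} (hρ : ρ ∈ P.rules) (hf : ρ.fn = f) : n < ρ.args.length := by
  obtain ⟨ρ', hρ', hf', hlt⟩ := h
  rwa [P.consistent ρ hρ ρ' hρ' (hf.trans hf'.symm)]

theorem forall₂_of_zip {α β : Type*} {R : α → β → Prop} {as : List α} {bs : List β}
    (hlen : as.length = bs.length) (h : ∀ p ∈ as.zip bs, R p.1 p.2) : List.Forall₂ R as bs :=
  List.forall₂_iff_zip.2 ⟨hlen, fun hp => h _ hp⟩

theorem zip_of_forall₂ {α β : Type*} {R : α → β → Prop} {as : List α} {bs : List β}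
    (h : List.Forall₂ R as bs) : as.length = bs.length ∧ ∀ p ∈ as.zip bs, R p.1 p.2 :=
  ⟨h.length_eq, fun _ hp => (List.forall₂_iff_zip.1 h).2 hp⟩

theorem forall₂_eq_of_unique {α : Type*} {R : α → α → Prop} {as bs : List α}
    (hR : ∀ a ∈ as, ∀ b, R a b → b = a) (h : List.Forall₂ R as bs) : bs = as := by
  induction h with
  | nil => rfl
  | cons hab _ ih =>
    simp only [List.mem_cons, forall_eq_or_imp] at hR
    rw [hR.1 _ hab, ih hR.2]

theorem forall₂_self {α : Type*} {R : α → α → Prop} {as : List α} (h : ∀ a ∈ as, R a a) :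
    List.Forall₂ R as as :=
  List.forall₂_same.2 h

/-- A value reduces to itself. -/
theorem Program.IsValue.eval_self {v : Term P.sig} (h : P.IsValue v) : P.Eval v v := by
  induction h with
  | data t ht =>
    induction ht with
    | con c args _ _ ih =>
      obtain ⟨h1, h2⟩ := zip_of_forall₂ (forall₂_self ih)
      exact .con c args args h1 h2
    | pair s t _ _ ihs iht => exact .pair _ _ _ _ ihs iht
  | pair s t _ _ ihs iht => exact .pair _ _ _ _ ihs iht
  | partialApp f vs hlt _ _ ih =>
    obtain ⟨h1, h2⟩ := zip_of_forall₂ (forall₂_self ih)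
    exact .partialApp f vs vs h1 hlt h2

/-- A value reduces to nothing but itself. -/
theorem Program.IsValue.eq_of_eval {v : Term P.sig} (h : P.IsValue v) :
    ∀ w, P.Eval v w → w = v := by
  induction h with
  | data t ht =>
    induction ht with
    | con c args _ _ ih =>
      intro w hw
      cases hw with
      | con _ _ vs hlen hev => rw [forall₂_eq_of_unique ih (forall₂_of_zip hlen hev)]
    | pair s t _ _ ihs iht =>
      intro w hw
      cases hw with
      | pair _ _ v' w' hs ht => rw [ihs _ hs, iht _ ht]
  | pair s t _ _ ihs iht =>
    intro w hw
    cases hw with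
    | pair _ _ v' w' hs ht => rw [ihs _ hs, iht _ ht]
  | partialApp f vs hlt _ _ ih =>
    intro w hw
    cases hw with
    | partialApp _ _ vs' hlen _ hev => rw [forall₂_eq_of_unique ih (forall₂_of_zip hlen hev)]
    | rule _ _ vs' hlen hev hval ρ hρ hf hle γ hγ hmatch w hw =>
      exact absurd (hlt.lt hρ hf) (by omega)

/-- `Res P t Φ`: the term `t` can be reduced to something, and everything it reduces to is a value
with property `Φ`. -/
def Res (P : Program) (t : Term P.sig) (Φ : Term P.sig → Prop) : Prop :=
  (∃ w, P.Eval t w) ∧ ∀ w, P.Eval t w → P.IsValue w ∧ Φ w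

theorem Res.mono {t : Term P.sig} {Φ Ψ : Term P.sig → Prop} (h : Res P t Φ)
    (hΦ : ∀ w, Φ w → Ψ w) : Res P t Ψ :=
  ⟨h.1, fun w hw => ⟨(h.2 w hw).1, hΦ w (h.2 w hw).2⟩⟩

theorem Res.value {v : Term P.sig} {Φ : Term P.sig → Prop} (hv : P.IsValue v) (h : Φ v) :
    Res P v Φ :=
  ⟨⟨v, hv.eval_self⟩, fun w hw => by rw [hv.eq_of_eval w hw]; exact ⟨hv, h⟩⟩

theorem Res.self {v : Term P.sig} (hv : P.IsValue v) : Res P v (v = ·) :=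
  Res.value hv rfl

theorem Res.pair {s t : Term P.sig} {Φ Ψ Θ : Term P.sig → Prop} (hs : Res P s Φ)
    (ht : Res P t Ψ) (h : ∀ u v, Φ u → Ψ v → Θ (.pair u v)) : Res P (.pair s t) Θ := by
  refine ⟨?_, ?_⟩
  · obtain ⟨⟨u, hu⟩, -⟩ := hs
    obtain ⟨⟨v, hv⟩, -⟩ := ht
    exact ⟨_, .pair _ _ _ _ hu hv⟩
  · intro w hw
    cases hw with
    | pair _ _ u v hu hv =>
      exact ⟨.pair _ _ (hs.2 u hu).1 (ht.2 v hv).1, h _ _ (hs.2 u hu).2 (ht.2 v hv).2⟩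

/-- Reduction of a call amounts to reducing the arguments and then the call on the values
obtained. -/
theorem Res.call {f : P.sig.Def} {ss : List (Term P.sig)} {Φs : List (Term P.sig → Prop)}
    {Ψ : Term P.sig → Prop} (hss : List.Forall₂ (Res P) ss Φs)
    (h : ∀ vs, (∀ v ∈ vs, P.IsValue v) → List.Forall₂ (fun (Φ : Term P.sig → Prop) v => Φ v) Φs vs →
      Res P (.app (.fn f) vs) Ψ) :
    Res P (.app (.fn f) ss) Ψ := by
  have key : ∀ vs, List.Forall₂ P.Eval ss vs → (∀ v ∈ vs, P.IsValue v) ∧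
      List.Forall₂ (fun (Φ : Term P.sig → Prop) v => Φ v) Φs vs := by
    clear h
    induction hss with
    | nil => intro vs hvs; cases hvs; simp
    | cons hs _ ih =>
      intro vs hvs
      cases hvs with
      | cons hv hvs =>
        obtain ⟨h1, h2⟩ := ih _ hvs
        exact ⟨by simpa using ⟨(hs.2 _ hv).1, h1⟩, .cons (hs.2 _ hv).2 h2⟩
  refine ⟨?_, ?_⟩
  · have hex : ∃ vs, List.Forall₂ P.Eval ss vs := by
      clear h key
      induction hss with
      | nil => exact ⟨[], .nil⟩
      | cons hs _ ih =>
        obtain ⟨vs, hvs⟩ := ih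
        obtain ⟨⟨v, hv⟩, -⟩ := hs
        exact ⟨v :: vs, .cons hv hvs⟩
    obtain ⟨vs, hvs⟩ := hex
    obtain ⟨hval, hΦ⟩ := key vs hvs
    obtain ⟨hlen, hev⟩ := zip_of_forall₂ hvs
    obtain ⟨⟨w, hw⟩, -⟩ := h vs hval hΦ
    cases hw with
    | partialApp _ _ vs' hlen' hlt hev' =>
      exact ⟨_, .partialApp f ss vs hlen (by rwa [hlen]) hev⟩
    | rule _ _ vs' hlen' hev' hval' ρ hρ hf hle γ hγ hmatch _ hw =>
      have hvs' : vs' = vs := forall₂_eq_of_unique (fun v hv => (hval v hv).eq_of_eval)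
        (forall₂_of_zip hlen' hev')
      subst hvs'
      exact ⟨w, .rule f ss vs' hlen hev hval ρ hρ hf (by omega) γ hγ hmatch w hw⟩
  · intro w hw
    cases hw with
    | partialApp _ _ vs hlen hlt hev =>
      obtain ⟨hval, hΦ⟩ := key vs (forall₂_of_zip hlen hev)
      obtain ⟨h1, h2⟩ := zip_of_forall₂ (forall₂_self fun v hv => (hval v hv).eval_self)
      exact (h vs hval hΦ).2 _ (.partialApp f vs vs h1 (by rwa [← hlen]) h2)
    | rule _ _ vs hlen hev hval' ρ hρ hf hle γ hγ hmatch _ hw =>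
      obtain ⟨hval, hΦ⟩ := key vs (forall₂_of_zip hlen hev)
      obtain ⟨h1, h2⟩ := zip_of_forall₂ (forall₂_self fun v hv => (hval v hv).eval_self)
      exact (h vs hval hΦ).2 _ (.rule f vs vs h1 h2 hval ρ hρ hf (by omega) γ hγ hmatch w hw)

/-- A call on values whose matching rules all have the same instance `t` of the right-hand side
has the results of `t`. -/
theorem Res.rule {f : P.sig.Def} {vs : List (Term P.sig)} {Φ : Term P.sig → Prop}
    {t : Term P.sig} (hvs : ∀ v ∈ vs, P.IsValue v) (ρ : Rule P.sig) (hρ : ρ ∈ P.rules)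
    (hf : ρ.fn = f) (γ : Var P.sig → Term P.sig) (hγ : IsSubstOn γ ρ.lhs.vars)
    (hm : vs = ρ.args.map (Term.subst γ)) (ht : ρ.rhs.subst γ = t)
    (huniq : ∀ ρ' ∈ P.rules, ρ'.fn = f → ∀ γ', vs = ρ'.args.map (Term.subst γ') →
      ρ'.rhs.subst γ' = t)
    (h : Res P t Φ) : Res P (.app (.fn f) vs) Φ := by
  have hlen : vs.length = ρ.args.length := by rw [hm, List.length_map]
  obtain ⟨h1, h2⟩ := zip_of_forall₂ (forall₂_self fun v hv => (hvs v hv).eval_self)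
  refine ⟨?_, ?_⟩
  · obtain ⟨⟨w, hw⟩, -⟩ := h
    refine ⟨w, .rule f vs vs h1 h2 hvs ρ hρ hf hlen.ge γ hγ ?_ w ?_⟩
    · rw [← hlen, List.take_length, hm]
    · rw [← hlen, List.drop_length, Term.applyTo_nil, ht]
      exact hw
  · intro w hw
    cases hw with
    | partialApp _ _ vs' hlen' hlt hev' => exact absurd (hlt.lt hρ hf) (by omega)
    | rule _ _ vs' hlen' hev' hval' ρ' hρ' hf' hle γ' hγ' hmatch _ hw =>
      have hvs' : vs' = vs := forall₂_eq_of_unique (fun v hv => (hvs v hv).eq_of_eval)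
        (forall₂_of_zip hlen' hev')
      subst hvs'
      have hlen2 : ρ'.args.length = vs'.length := by
        rw [hlen, P.consistent ρ' hρ' ρ hρ (hf'.trans hf.symm)]
      rw [hlen2, List.take_length] at hmatch
      rw [hlen2, List.drop_length, Term.applyTo_nil, huniq ρ' hρ' hf' γ' hmatch] at hw
      exact h.2 w hw

/-- Values of type `σ`. -/
def Val (P : Program) (σ : Ty P.sig.Srt) (v : Term P.sig) : Prop :=
  P.IsValue v ∧ HasType v σ

/-- Values of a functional type are partially applied defined symbols. -/
theorem Val.exists_fn {σ τ : Ty P.sig.Srt} {v : Term P.sig} (h : Val P (.arrow σ τ) v) :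
    ∃ f vs, v = .app (.fn f) vs ∧ ∀ u ∈ vs, P.IsValue u := by
  obtain ⟨hv, hty⟩ := h
  cases hv with
  | data t ht =>
    cases ht with
    | con => cases hty
    | pair => cases hty
  | pair => cases hty
  | partialApp f vs _ hvs _ => exact ⟨f, vs, rfl, hvs⟩

/-- Reduction of an application of a functional value amounts to reducing the argument first. -/
theorem Res.apply {σ τ : Ty P.sig.Srt} {F s : Term P.sig} {Φ Ψ : Term P.sig → Prop}
    (hF : Val P (.arrow σ τ) F) (hs : Res P s Φ)
    (h : ∀ u, Φ u → Res P (F.applyTo [u]) Ψ) : Res P (F.applyTo [s]) Ψ := by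
  obtain ⟨f, vs, rfl, hvs⟩ := hF.exists_fn
  refine Res.call (Φs := vs.map (fun v => (v = ·)) ++ [Φ]) ?_ ?_
  · refine List.rel_append ?_ (.cons hs .nil)
    clear h hF
    induction vs with
    | nil => exact .nil
    | cons v vs ih =>
      simp only [List.mem_cons, forall_eq_or_imp] at hvs
      exact .cons (Res.self hvs.1) (ih hvs.2)
  · intro us hvals hus
    clear hvals
    obtain ⟨u, rfl, hu⟩ : ∃ u, us = vs ++ [u] ∧ Φ u := by
      clear h hvs hF
      induction vs generalizing us with
      | nil =>
        cases hus with
        | cons h1 h2 => cases h2; exact ⟨_, rfl, h1⟩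
      | cons v vs ih =>
        cases hus with
        | cons h1 h2 =>
          obtain ⟨u, rfl, hu⟩ := ih _ h2
          exact ⟨u, by simp [h1], hu⟩
    exact h u hu

end Results

end ConsFree

namespace ConsFree

/-! ### The program of a cellular automaton -/

/-- A one-dimensional cellular automaton with finitely many cell contents, whose initial row is
`wall`, `first`, the letters of the input (encoded by `sym`), and then `blank` forever. `loc` is the
local rule, and `acc` marks the accepting cells. -/
structure Automaton where
  C : Type
  [fintypeC : Fintype C]
  wall : C
  first : C
  blank : C
  sym : Bool → C
  loc : C → C → C → C
  acc : C → Bool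

attribute [instance] Automaton.fintypeC

/-- The sorts: truth values, lists of truth values, and cell contents. -/
inductive Srt : Type
  | bool
  | list
  | cell

/-- The constructors. Every cell content is a constant. -/
inductive Con (C : Type) : Type
  | bool (b : Bool)
  | nil
  | cons
  | cell (c : C)
  deriving Fintype

/-- The defined symbols, for counters of the levels `0, …, L`. `op g` computes the Boolean operation
`g`; `sym`, `loc` and `out` are the tables of the automaton. `init` is the initial row of the
space-time diagram, with the auxiliary symbols `init1`, `init2`, `rd`, `rd1`; `rd s v` reads the letter
at position `v` of the list `s`. `cell t u` is the content of cell `u` in row `t`. At each level,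
`max`, `pred` and `zero` are the largest counter, the predecessor and the test for zero.
`below F i` says whether a bit of `F` with a position less than `i` is set. -/
inductive Fn (L : ℕ) : Type
  | start
  | op (g : Bool → Bool → Bool)
  | sym
  | loc
  | out
  | init
  | init1
  | init2
  | rd
  | rd1
  | cell
  | cell1
  | max (l : Fin (L + 1))
  | pred (l : Fin (L + 1))
  | zero (l : Fin (L + 1))
  | below (l : Fin L)
  | below1 (l : Fin L)
  deriving Fintype

/-- The type of the counters of level `l`. The first `d` levels after level `0` add a component of
type `list` to a tuple, the later ones pass from `σ` to `σ ⇒ bool`. -/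
def counterTy (d : ℕ) : ℕ → Ty Srt
  | 0 => .sort .bool
  | l + 1 => if l < d then .prod (counterTy d l) (.sort .list)
      else .arrow (counterTy d l) (.sort .bool)

/-- The argument types of the constructors. -/
def Con.args {C : Type} : Con C → List (Ty Srt)
  | .cons => [.sort .bool, .sort .list]
  | _ => []

/-- The sorts of the constructors. -/
def Con.srt {C : Type} : Con C → Srt
  | .bool _ => .bool
  | .nil => .list
  | .cons => .list
  | .cell _ => .cell

/-- The types of the defined symbols. Those that handle counters take the input as their first
argument, which becomes the last component of a tuple after a borrow. -/
def Fn.ty (d : ℕ) {L : ℕ} : Fn L → Ty Srt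
  | .start => .arrow (.sort .list) (.sort .bool)
  | .op _ => .arrow (.sort .bool) (.arrow (.sort .bool) (.sort .bool))
  | .sym => .arrow (.sort .bool) (.sort .cell)
  | .loc => .arrow (.sort .cell) (.arrow (.sort .cell) (.arrow (.sort .cell) (.sort .cell)))
  | .out => .arrow (.sort .cell) (.sort .bool)
  | .init => .arrow (.sort .list) (.arrow (counterTy d L) (.sort .cell))
  | .init1 => .arrow (.sort .list) (.arrow (counterTy d L) (.arrow (.sort .bool) (.sort .cell)))
  | .init2 => .arrow (.sort .list) (.arrow (counterTy d L) (.arrow (.sort .bool) (.sort .cell)))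
  | .rd => .arrow (.sort .list) (.arrow (.sort .list) (.arrow (counterTy d L) (.sort .cell)))
  | .rd1 => .arrow (.sort .list) (.arrow (.sort .bool) (.arrow (.sort .list)
      (.arrow (counterTy d L) (.arrow (.sort .bool) (.sort .cell)))))
  | .cell => .arrow (.sort .list) (.arrow (counterTy d L) (.arrow (counterTy d L) (.sort .cell)))
  | .cell1 => .arrow (.sort .list) (.arrow (counterTy d L) (.arrow (counterTy d L)
      (.arrow (.sort .bool) (.arrow (.sort .bool) (.sort .cell)))))
  | .max l => .arrow (.sort .list) (counterTy d l)
  | .pred l => .arrow (.sort .list) (.arrow (counterTy d l) (counterTy d l))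
  | .zero l => .arrow (.sort .list) (.arrow (counterTy d l) (.sort .bool))
  | .below l => .arrow (.sort .list) (.arrow (counterTy d (l + 1)) (.arrow (counterTy d l)
      (.sort .bool)))
  | .below1 l => .arrow (.sort .list) (.arrow (counterTy d (l + 1)) (.arrow (counterTy d l)
      (.arrow (.sort .bool) (.sort .bool))))

/-- The signature of the program simulating `A` with `d` levels of tuples and `k` levels of
functions. -/
@[reducible] def Automaton.sig (A : Automaton) (d k : ℕ) : Signature where
  Srt := Srt
  Con := Con A.C
  Def := Fn (d + k)
  conArgs := Con.args
  conSort := Con.srt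
  conArgs_order := by
    intro c
    cases c <;> simp [Con.args, Ty.order]
  defTy := Fn.ty d

section Rules

variable {A : Automaton} {d k : ℕ}

/-- Terms headed by defined symbols, constructors and variables. -/
abbrev fnT (f : Fn (d + k)) (ts : List (Term (A.sig d k))) : Term (A.sig d k) := .app (.fn f) ts

abbrev conT (c : Con A.C) (ts : List (Term (A.sig d k))) : Term (A.sig d k) := .app (.con c) ts

abbrev varT (i : ℕ) (σ : Ty Srt) (ts : List (Term (A.sig d k))) : Term (A.sig d k) :=
  .app (.var ⟨i, σ⟩) ts

abbrev bitT (b : Bool) : Term (A.sig d k) := conT (.bool b) []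

abbrev cellT (c : A.C) : Term (A.sig d k) := conT (.cell c) []

/-- The variable for the input. -/
abbrev inp : Term (A.sig d k) := varT 0 (.sort .list) []

/-- Variables `i` for a list, a truth value, and a counter of level `l`. -/
abbrev lvar (i : ℕ) : Term (A.sig d k) := varT i (.sort .list) []

abbrev bvar (i : ℕ) : Term (A.sig d k) := varT i (.sort .bool) []

abbrev cvar (i l : ℕ) : Term (A.sig d k) := varT i (counterTy d l) []

variable (A d k)

/-- The rules for one symbol: argument patterns and right-hand sides. -/
abbrev Body : Type := List (List (Term (A.sig d k)) × Term (A.sig d k))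

/-- The rules for the largest counter. All bits of a functional one are set. -/
def maxBody : Fin (d + k + 1) → Body A d k :=
  Fin.cases [([inp], bitT true)] fun l =>
    if l < d then [([inp], .pair (fnT (.max l.castSucc) [inp]) inp)]
    else [([inp, cvar 1 l], bitT true)]

/-- The rules for the predecessor, which takes `0` to the largest counter. In the binary
representation bit `i` of the predecessor is bit `i` of the argument, negated if no lower bit is
set. -/
def predBody : Fin (d + k + 1) → Body A d k :=
  Fin.cases [([inp, bvar 1], bitT true)] fun l =>
    if l < d then
      [([inp, .pair (cvar 1 l) (conT .nil [])],
          .pair (fnT (.pred l.castSucc) [inp, cvar 1 l]) inp),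
        ([inp, .pair (cvar 1 l) (conT .cons [bvar 2, lvar 3])], .pair (cvar 1 l) (lvar 3))]
    else
      [([inp, cvar 1 (l + 1), cvar 2 l],
          fnT (.op (· == ·)) [fnT (.below l) [inp, cvar 1 (l + 1), cvar 2 l],
            varT 1 (counterTy d (l + 1)) [cvar 2 l]])]

/-- The rules for the test for zero. A functional counter is zero if neither the highest bit nor a
lower one is set. -/
def zeroBody : Fin (d + k + 1) → Body A d k :=
  Fin.cases [([inp, bvar 1], bitT true)] fun l =>
    if l < d then
      [([inp, .pair (cvar 1 l) (conT .nil [])], fnT (.zero l.castSucc) [inp, cvar 1 l]),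
        ([inp, .pair (cvar 1 l) (conT .cons [bvar 2, lvar 3])], bitT false)]
    else
      [([inp, cvar 1 (l + 1)],
          fnT (.op fun a b => !a && !b)
            [varT 1 (counterTy d (l + 1)) [fnT (.max l.castSucc) [inp]],
              fnT (.below l) [inp, cvar 1 (l + 1), fnT (.max l.castSucc) [inp]]])]

/-- The rules of the program, for each defined symbol. Arguments are evaluated before a rule is
applied, so that branching on a test takes an auxiliary symbol with the result of the test as an
additional argument. -/
noncomputable def body : Fn (d + k) → Body A d k
  | .start => [([inp], fnT .out [fnT .cell [inp, fnT (.max (Fin.last _)) [inp],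
      fnT (.max (Fin.last _)) [inp]]])]
  | .op g => [true, false].flatMap fun a => [true, false].map fun b =>
      ([bitT a, bitT b], bitT (g a b))
  | .sym => [true, false].map fun b => ([bitT b], cellT (A.sym b))
  | .loc => (Finset.univ : Finset (A.C × A.C × A.C)).toList.map fun c =>
      ([cellT c.1, cellT c.2.1, cellT c.2.2], cellT (A.loc c.1 c.2.1 c.2.2))
  | .out => (Finset.univ : Finset A.C).toList.map fun c => ([cellT c], bitT (A.acc c))
  | .init => [([inp, cvar 1 (d + k)],
      fnT .init1 [inp, cvar 1 (d + k), fnT (.zero (Fin.last _)) [inp, cvar 1 (d + k)]])]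
  | .init1 => [([inp, cvar 1 (d + k), bitT true], cellT A.wall),
      ([inp, cvar 1 (d + k), bitT false],
        fnT .init2 [inp, fnT (.pred (Fin.last _)) [inp, cvar 1 (d + k)],
          fnT (.zero (Fin.last _)) [inp, fnT (.pred (Fin.last _)) [inp, cvar 1 (d + k)]]])]
  | .init2 => [([inp, cvar 1 (d + k), bitT true], cellT A.first),
      ([inp, cvar 1 (d + k), bitT false],
        fnT .rd [inp, inp, fnT (.pred (Fin.last _)) [inp, cvar 1 (d + k)]])]
  | .rd => [([inp, conT .nil [], cvar 1 (d + k)], cellT A.blank),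
      ([inp, conT .cons [bvar 2, lvar 3], cvar 1 (d + k)],
        fnT .rd1 [inp, bvar 2, lvar 3, cvar 1 (d + k),
          fnT (.zero (Fin.last _)) [inp, cvar 1 (d + k)]])]
  | .rd1 => [([inp, bvar 2, lvar 3, cvar 1 (d + k), bitT true], fnT .sym [bvar 2]),
      ([inp, bvar 2, lvar 3, cvar 1 (d + k), bitT false],
        fnT .rd [inp, lvar 3, fnT (.pred (Fin.last _)) [inp, cvar 1 (d + k)]])]
  | .cell => [([inp, cvar 1 (d + k), cvar 2 (d + k)],
      fnT .cell1 [inp, cvar 1 (d + k), cvar 2 (d + k),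
        fnT (.zero (Fin.last _)) [inp, cvar 1 (d + k)],
        fnT (.zero (Fin.last _)) [inp, cvar 2 (d + k)]])]
  | .cell1 => [([inp, cvar 1 (d + k), cvar 2 (d + k), bitT true, bvar 3],
        fnT .init [inp, cvar 2 (d + k)]),
      ([inp, cvar 1 (d + k), cvar 2 (d + k), bitT false, bitT true], cellT A.wall),
      ([inp, cvar 1 (d + k), cvar 2 (d + k), bitT false, bitT false],
        fnT .loc
          [fnT .cell [inp, fnT (.pred (Fin.last _)) [inp, cvar 1 (d + k)],
            fnT (.pred (Fin.last _)) [inp, fnT (.pred (Fin.last _)) [inp, cvar 2 (d + k)]]],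
          fnT .cell [inp, fnT (.pred (Fin.last _)) [inp, cvar 1 (d + k)],
            fnT (.pred (Fin.last _)) [inp, cvar 2 (d + k)]],
          fnT .cell [inp, fnT (.pred (Fin.last _)) [inp, cvar 1 (d + k)], cvar 2 (d + k)]])]
  | .max l => maxBody A d k l
  | .pred l => predBody A d k l
  | .zero l => zeroBody A d k l
  | .below l => if l < d then []
      else [([inp, cvar 1 (l + 1), cvar 2 l],
        fnT (.below1 l) [inp, cvar 1 (l + 1), cvar 2 l, fnT (.zero l.castSucc) [inp, cvar 2 l]])]
  | .below1 l => if l < d then []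
      else [([inp, cvar 1 (l + 1), cvar 2 l, bitT true], bitT false),
        ([inp, cvar 1 (l + 1), cvar 2 l, bitT false],
          fnT (.op (· || ·))
            [varT 1 (counterTy d (l + 1)) [fnT (.pred l.castSucc) [inp, cvar 2 l]],
              fnT (.below l) [inp, cvar 1 (l + 1), fnT (.pred l.castSucc) [inp, cvar 2 l]]])]

end Rules

/-! ### Syntactic properties of the program -/

section Conditions

variable {S : Signature}

theorem subterm_app {t : Term S} {h : Head S} {args : List (Term S)} :
    Subterm t (.app h args) ↔ t = .app h args ∨ ∃ u ∈ args, Subterm t u := by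
  constructor
  · intro H
    cases H with
    | refl => exact .inl rfl
    | app _ _ u hu ht => exact .inr ⟨u, hu, ht⟩
  · rintro (rfl | ⟨u, hu, ht⟩)
    · exact .refl
    · exact .app _ _ u hu ht

theorem subterm_pair {t u v : Term S} :
    Subterm t (.pair u v) ↔ t = .pair u v ∨ Subterm t u ∨ Subterm t v := by
  constructor
  · intro H
    cases H with
    | refl => exact .inl rfl
    | left _ _ h => exact .inr (.inl h)
    | right _ _ h => exact .inr (.inr h)
  · rintro (rfl | h | h)
    · exact .refl
    · exact .left _ _ h
    · exact .right _ _ h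

/-- `TypedArgs σ ts τ`: something of type `σ` can be applied to the arguments `ts`, and the result
has type `τ`. -/
def TypedArgs : Ty S.Srt → List (Term S) → Ty S.Srt → Prop
  | σ, [], τ => σ = τ
  | .arrow σ ρ, t :: ts, τ => HasType t σ ∧ TypedArgs ρ ts τ
  | _, _ :: _, _ => False

theorem typedArgs_iff {σ τ : Ty S.Srt} {ts : List (Term S)} :
    TypedArgs σ ts τ ↔ ∃ σs, σ = Ty.arrows σs τ ∧ List.Forall₂ HasType ts σs := by
  constructor
  · intro h
    induction ts generalizing σ with
    | nil =>
      simp only [TypedArgs] at h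
      exact ⟨[], h, .nil⟩
    | cons t ts ih =>
      cases σ with
      | arrow σ ρ =>
        obtain ⟨σs, rfl, h2⟩ := ih h.2
        exact ⟨σ :: σs, rfl, .cons h.1 h2⟩
      | sort | prod => exact h.elim
  · rintro ⟨σs, rfl, h⟩
    induction h with
    | nil => simp [TypedArgs, Ty.arrows]
    | cons h1 _ ih => exact ⟨h1, ih⟩

theorem hasType_fn {f : S.Def} {ts : List (Term S)} {τ : Ty S.Srt} :
    HasType (.app (.fn f) ts) τ ↔ TypedArgs (S.defTy f) ts τ := by
  rw [typedArgs_iff]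
  constructor
  · intro h
    cases h with
    | fn _ _ σs _ hf hlen hargs => exact ⟨σs, hf, forall₂_of_zip hlen hargs⟩
  · rintro ⟨σs, hf, h⟩
    exact .fn f ts σs τ hf (zip_of_forall₂ h).1 (zip_of_forall₂ h).2

theorem hasType_var {x : Var S} {ts : List (Term S)} {τ : Ty S.Srt} :
    HasType (.app (.var x) ts) τ ↔ TypedArgs x.ty ts τ := by
  rw [typedArgs_iff]
  constructor
  · intro h
    cases h with
    | var _ _ σs _ hf hlen hargs => exact ⟨σs, hf, forall₂_of_zip hlen hargs⟩
  · rintro ⟨σs, hf, h⟩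
    exact .var x ts σs τ hf (zip_of_forall₂ h).1 (zip_of_forall₂ h).2

theorem hasType_con {c : S.Con} {ts : List (Term S)} {τ : Ty S.Srt} :
    HasType (.app (.con c) ts) τ ↔
      .sort (S.conSort c) = τ ∧ List.Forall₂ HasType ts (S.conArgs c) := by
  constructor
  · intro h
    cases h with
    | con _ _ hlen hargs => exact ⟨rfl, forall₂_of_zip hlen hargs⟩
  · rintro ⟨rfl, h⟩
    exact .con c ts (zip_of_forall₂ h).1 (zip_of_forall₂ h).2

theorem hasType_pair {s t : Term S} {ρ : Ty S.Srt} :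
    HasType (.pair s t) ρ ↔ ∃ σ τ, .prod σ τ = ρ ∧ HasType s σ ∧ HasType t τ := by
  constructor
  · intro h
    cases h with
    | pair _ _ σ τ hs ht => exact ⟨σ, τ, rfl, hs, ht⟩
  · rintro ⟨σ, τ, rfl, hs, ht⟩
    exact .pair _ _ _ _ hs ht

variable {A : Automaton} {d k : ℕ}

/-- The types of the variables of the program. -/
def VarTy (d k : ℕ) (σ : Ty Srt) : Prop := (∃ s, σ = .sort s) ∨ ∃ l ≤ d + k, σ = counterTy d l

theorem varTy_sort (s : Srt) : VarTy d k (.sort s) := .inl ⟨s, rfl⟩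

theorem varTy_counterTy {l : ℕ} (h : l ≤ d + k) : VarTy d k (counterTy d l) := .inr ⟨l, h, rfl⟩

/-- The conditions on a rule of the program. The only constructor terms on right-hand sides are
constants. -/
structure GoodRule (ρ : Rule (A.sig d k)) : Prop where
  no_defined : ∀ l ∈ ρ.args, ∀ f ts, ¬ Subterm (.app (.fn f) ts) l
  linear : ρ.lhs.vars.Nodup
  vars_subset : ∀ x ∈ ρ.rhs.vars, x ∈ ρ.lhs.vars
  typed : ∃ τ, HasType ρ.lhs τ ∧ HasType ρ.rhs τ
  constants : ∀ c ts, Subterm (.app (.con c) ts) ρ.rhs → ts = [] ∧ c.args = []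
  varTy : ∀ x ∈ ρ.lhs.vars, VarTy d k x.ty

attribute [local simp] Rule.lhs Term.vars varsList Head.vars subterm_app subterm_pair hasType_fn
  hasType_var hasType_con hasType_pair TypedArgs Fn.ty Con.args Con.srt varTy_sort varTy_counterTy

theorem goodRule_max (l : Fin (d + k + 1)) (r) (hr : r ∈ maxBody A d k l) :
    GoodRule (A := A) ⟨.max l, r.1, r.2⟩ := by
  induction l using Fin.cases with
  | zero =>
    simp only [maxBody, Fin.cases_zero, List.mem_singleton] at hr
    subst hr
    constructor <;> simp [counterTy]
  | succ l =>
    have hl : VarTy d k (counterTy d l) := varTy_counterTy l.2.le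
    simp only [maxBody, Fin.cases_succ] at hr
    split_ifs at hr with h <;> simp only [List.mem_cons, List.not_mem_nil, or_false] at hr <;>
      subst hr <;> constructor <;> simp [counterTy, h, hl]

theorem goodRule_pred (l : Fin (d + k + 1)) (r) (hr : r ∈ predBody A d k l) :
    GoodRule (A := A) ⟨.pred l, r.1, r.2⟩ := by
  induction l using Fin.cases with
  | zero =>
    simp only [predBody, Fin.cases_zero, List.mem_singleton] at hr
    subst hr
    constructor <;> simp [counterTy]
  | succ l =>
    have hl : VarTy d k (counterTy d l) := varTy_counterTy l.2.le
    have hl' : VarTy d k (counterTy d (l + 1)) := varTy_counterTy l.2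
    simp only [predBody, Fin.cases_succ] at hr
    split_ifs at hr with h <;> simp only [List.mem_cons, List.not_mem_nil, or_false] at hr
    · rcases hr with rfl | rfl <;> constructor <;> simp [counterTy, h, hl]
    · subst hr
      simp only [counterTy, h, if_false] at hl'
      constructor <;> simp [counterTy, h, hl, hl']

theorem goodRule_zero (l : Fin (d + k + 1)) (r) (hr : r ∈ zeroBody A d k l) :
    GoodRule (A := A) ⟨.zero l, r.1, r.2⟩ := by
  induction l using Fin.cases with
  | zero =>
    simp only [zeroBody, Fin.cases_zero, List.mem_singleton] at hr
    subst hr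
    constructor <;> simp [counterTy]
  | succ l =>
    have hl : VarTy d k (counterTy d l) := varTy_counterTy l.2.le
    have hl' : VarTy d k (counterTy d (l + 1)) := varTy_counterTy l.2
    simp only [zeroBody, Fin.cases_succ] at hr
    split_ifs at hr with h <;> simp only [List.mem_cons, List.not_mem_nil, or_false] at hr
    · rcases hr with rfl | rfl <;> constructor <;> simp [counterTy, h, hl]
    · subst hr
      simp only [counterTy, h, if_false] at hl'
      constructor <;> simp [counterTy, h, hl']

theorem body_good (f : Fn (d + k)) (r) (hr : r ∈ body A d k f) :
    GoodRule (A := A) ⟨f, r.1, r.2⟩ := by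
  cases f with
  | max l => exact goodRule_max l r hr
  | pred l => exact goodRule_pred l r hr
  | zero l => exact goodRule_zero l r hr
  | loc =>
    simp only [body, List.mem_map] at hr
    obtain ⟨c, -, rfl⟩ := hr
    constructor <;> simp
  | out =>
    simp only [body, List.mem_map] at hr
    obtain ⟨c, -, rfl⟩ := hr
    constructor <;> simp
  | op g =>
    simp only [body, List.mem_flatMap, List.mem_map] at hr
    obtain ⟨a, -, b, -, rfl⟩ := hr
    constructor <;> simp
  | sym =>
    simp only [body, List.mem_map] at hr
    obtain ⟨b, -, rfl⟩ := hr
    constructor <;> simp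
  | below l | below1 l =>
    have hl : VarTy d k (counterTy d l) := varTy_counterTy l.2.le
    have hl' : VarTy d k (counterTy d (l + 1)) := varTy_counterTy l.2
    simp only [body] at hr
    split_ifs at hr with h <;> simp only [List.mem_cons, List.not_mem_nil, or_false] at hr
    simp only [counterTy, h, if_false] at hl'
    first
      | subst hr
        constructor <;> simp [counterTy, h, hl, hl']
      | rcases hr with rfl | rfl <;> constructor <;> simp [counterTy, h, hl, hl']
  | _ =>
    simp only [body, List.mem_cons, List.not_mem_nil, or_false] at hr
    first
      | subst hr
        constructor <;> simp
      | rcases hr with rfl | rfl <;> constructor <;> simp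
      | rcases hr with rfl | rfl | rfl <;> constructor <;> simp

/-- All rules for the same symbol have the same number of arguments. -/
theorem body_length (f : Fn (d + k)) (r) (hr : r ∈ body A d k f) (r') (hr' : r' ∈ body A d k f) :
    r.1.length = r'.1.length := by
  have key : ∃ n, ∀ r ∈ body A d k f, r.1.length = n := by
    cases f with
    | max l =>
      simp only [body]
      induction l using Fin.cases with
      | zero => exact ⟨1, by simp [maxBody]⟩
      | succ l => simp only [maxBody, Fin.cases_succ]; split_ifs <;> simp
    | pred l =>
      simp only [body]
      induction l using Fin.cases with
      | zero => exact ⟨2, by simp [predBody]⟩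
      | succ l => simp only [predBody, Fin.cases_succ]; split_ifs <;> simp
    | zero l =>
      simp only [body]
      induction l using Fin.cases with
      | zero => exact ⟨2, by simp [zeroBody]⟩
      | succ l => simp only [zeroBody, Fin.cases_succ]; split_ifs <;> simp
    | loc =>
      refine ⟨3, fun r h => ?_⟩
      simp only [body, List.mem_map] at h
      obtain ⟨c, -, rfl⟩ := h
      rfl
    | out => exact ⟨1, by simp +contextual [body]⟩
    | below | below1 => simp only [body]; split_ifs <;> simp
    | _ => simp [body]
  obtain ⟨n, hn⟩ := key
  rw [hn r hr, hn r' hr']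

variable (A d k)

/-- The program that runs the automaton `A`. -/
@[reducible] noncomputable def Automaton.program : Program where
  sig := A.sig d k
  rules := (Finset.univ : Finset (Fn (d + k))).toList.flatMap fun f =>
    (body A d k f).map fun r => ⟨f, r.1, r.2⟩
  wellFormed := by
    intro ρ hρ
    simp only [List.mem_flatMap, List.mem_map] at hρ
    obtain ⟨f, -, r, hr, rfl⟩ := hρ
    have h := body_good f r hr
    exact ⟨h.no_defined, h.linear, h.vars_subset, h.typed⟩
  consistent := by
    intro ρ hρ ρ' hρ' h
    simp only [List.mem_flatMap, List.mem_map] at hρ hρ'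
    obtain ⟨f, -, r, hr, rfl⟩ := hρ
    obtain ⟨f', -, r', hr', rfl⟩ := hρ'
    obtain rfl : f = f' := h
    exact body_length f r hr r' hr'

variable {A d k}

theorem mem_rules {ρ : Rule (A.sig d k)} :
    ρ ∈ (A.program d k).rules ↔ (ρ.args, ρ.rhs) ∈ body A d k ρ.fn := by
  simp only [List.mem_flatMap, List.mem_map, Finset.mem_toList, Finset.mem_univ, true_and]
  constructor
  · rintro ⟨f, r, hr, rfl⟩
    exact hr
  · intro h
    exact ⟨ρ.fn, _, h, rfl⟩

theorem program_goodRule {ρ : Rule (A.sig d k)} (h : ρ ∈ (A.program d k).rules) : GoodRule ρ :=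
  body_good ρ.fn _ (mem_rules.1 h)

theorem program_isConsFree : (A.program d k).IsConsFree := by
  intro ρ hρ c ts h
  obtain ⟨rfl, hc⟩ := (program_goodRule hρ).constants c ts h
  have h0 : List.Forall₂ HasType ([] : List (Term (A.sig d k))) (Con.args c) := by
    rw [hc]
    exact .nil
  exact .inl (.con c [] (hasType_con.2 ⟨rfl, h0⟩) (by simp))

/-- Tuples have order `0`, and each functional level adds one to the order. -/
theorem order_counterTy (l : ℕ) : (counterTy d l).order = l - d := by
  induction l with
  | zero => simp [counterTy, Ty.order]
  | succ l ih =>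
    simp only [counterTy]
    split_ifs with h <;> simp only [Ty.order, ih] <;> omega

theorem VarTy.order_le {σ : Ty Srt} (h : VarTy d k σ) : σ.order ≤ k := by
  rcases h with ⟨s, rfl⟩ | ⟨l, hl, rfl⟩
  · simp [Ty.order]
  · rw [order_counterTy]
    omega

theorem VarTy.unary {σ : Ty Srt} (h : VarTy d k σ) :
    σ.order = 0 ∨ ∃ σ' ι : Ty Srt, ι.order = 0 ∧ σ = .arrow σ' ι := by
  rcases h with ⟨s, rfl⟩ | ⟨l, hl, rfl⟩
  · simp [Ty.order]
  · rw [order_counterTy]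
    by_cases h : l ≤ d
    · left
      omega
    · right
      obtain ⟨l, rfl⟩ := Nat.exists_eq_succ_of_ne_zero (by omega : l ≠ 0)
      exact ⟨counterTy d l, .sort .bool, rfl, by simp only [counterTy]; rw [if_neg (by omega)]⟩

theorem program_varTy {ρ : Rule (A.sig d k)} (hρ : ρ ∈ (A.program d k).rules) {x}
    (hx : x ∈ ρ.lhs.vars ++ ρ.rhs.vars) : VarTy d k x.ty := by
  have h := program_goodRule hρ
  rcases List.mem_append.1 hx with hx | hx
  · exact h.varTy x hx
  · exact h.varTy x (h.vars_subset x hx)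

theorem program_unaryVariables : (A.program d k).UnaryVariables :=
  fun _ hρ _ hx => (program_varTy hρ hx).unary

theorem maxOrder_le {B : Type} {σs : List (Ty B)} {n : ℕ} :
    maxOrder σs ≤ n ↔ ∀ σ ∈ σs, σ.order ≤ n := by
  induction σs with
  | nil => simp [maxOrder]
  | cons σ σs ih =>
    simp only [maxOrder, List.map_cons, List.foldr_cons, max_le_iff, List.mem_cons,
      forall_eq_or_imp] at ih ⊢
    rw [ih]

theorem order_le_of_mem_args {B : Type} {σ τ : Ty B} (h : τ ∈ σ.args) : τ.order ≤ σ.order := by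
  induction σ with
  | sort => simp [Ty.args] at h
  | prod => simp [Ty.args] at h
  | arrow σ ρ _ ih =>
    simp only [Ty.args, List.mem_cons] at h
    rcases h with rfl | h
    · simp [Ty.order]
    · exact (ih h).trans (by simp [Ty.order])

theorem program_dataOrder : (A.program d k).dataOrder = k := by
  have hN : ∀ l ≤ d + k, (counterTy d l).order ≤ k := fun l hl => (varTy_counterTy hl).order_le
  apply le_antisymm
  · refine max_le (Finset.sup_le fun f hf => maxOrder_le.2 fun σ hσ => ?_) (maxOrder_le.2 ?_)
    · clear hf
      have hs : ∀ s : Srt, (Ty.sort s).order ≤ k := fun s => by simp [Ty.order]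
      have ha : ∀ l ≤ d + k, ∀ σ ∈ (counterTy d l).args, σ.order ≤ k :=
        fun l hl σ hσ => (order_le_of_mem_args hσ).trans (hN l hl)
      cases f <;> simp only [Fn.ty, Ty.args, List.mem_cons, List.not_mem_nil, or_false] at hσ
      case max l =>
        rcases hσ with rfl | hσ
        · exact hs _
        · exact ha l (by omega) σ hσ
      case pred l =>
        rcases hσ with rfl | rfl | hσ
        · exact hs _
        · exact hN l (by omega)
        · exact ha l (by omega) σ hσ
      case zero l =>
        rcases hσ with rfl | rfl
        · exact hs _
        · exact hN l (by omega)
      case below l =>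
        rcases hσ with rfl | rfl | rfl
        · exact hs _
        · exact hN _ (by omega)
        · exact hN _ (by omega)
      case below1 l =>
        rcases hσ with rfl | rfl | rfl | rfl
        · exact hs _
        · exact hN _ (by omega)
        · exact hN _ (by omega)
        · exact hs _
      all_goals
        (repeat' rcases hσ with rfl | hσ) <;> first | exact hs _ | exact hN _ le_rfl
    · intro σ hσ
      obtain ⟨ρ, hρ, hσ⟩ := List.mem_flatMap.1 hσ
      obtain ⟨x, hx, rfl⟩ := List.mem_map.1 hσ
      exact (program_varTy hρ hx).order_le
  · -- The order `k` is attained by the counters of the last level.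
    refine le_max_of_le_left ?_
    refine le_trans ?_ (Finset.le_sup (f := fun f : Fn (d + k) => maxOrder (Fn.ty d f).args)
      (Finset.mem_univ Fn.init))
    refine le_trans ?_ (maxOrder_le.1 le_rfl (counterTy d (d + k)) (by simp [Fn.ty, Ty.args]))
    rw [order_counterTy]
    omega

end Conditions

end ConsFree

namespace ConsFree

/-! ### Evaluation of the program: auxiliary functions -/

section Run

variable {A : Automaton} {d k : ℕ}

/-- The assignment of the terms `ts` to the variables with names `0, 1, …`, regardless of their
types: in each rule the variables have different names. -/
def env (ts : List (Term (A.sig d k))) (y : Var (A.sig d k)) : Term (A.sig d k) :=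
  ts.getD y.name (conT .nil [])

/-- The encoding of words as data terms. -/
def enc : List Bool → Term (A.sig d k)
  | [] => conT .nil []
  | b :: s => conT .cons [bitT b, enc s]

/-- A call on values is reduced with the only rule that matches. -/
theorem Res.step {f : Fn (d + k)} {vs : List (Term (A.sig d k))} {t : Term (A.sig d k)}
    {Φ : Term (A.sig d k) → Prop} (ts : List (Term (A.sig d k)))
    (r : List (Term (A.sig d k)) × Term (A.sig d k)) (hr : r ∈ body A d k f)
    (hm : r.1.map (Term.subst (env ts)) = vs) (ht : r.2.subst (env ts) = t)
    (hts : ∀ y ∈ varsList r.1, Val (A.program d k) y.ty (env ts y))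
    (hvs : ∀ v ∈ vs, (A.program d k).IsValue v)
    (huniq : ∀ r ∈ body A d k f, ∀ γ, vs = r.1.map (Term.subst γ) → r.2.subst γ = t)
    (h : Res (A.program d k) t Φ) : Res (A.program d k) (fnT f vs) Φ := by
  refine Res.rule hvs ⟨f, r.1, r.2⟩ (mem_rules.2 hr) rfl (env ts) ?_ hm.symm ht ?_ h
  · intro y hy
    have hy' : y ∈ varsList r.1 := by simpa [Rule.lhs, Term.vars, Head.vars] using hy
    exact ⟨(hts y hy').1.ground, (hts y hy').2⟩
  · rintro ρ hρ rfl γ hγ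
    exact huniq _ (mem_rules.1 hρ) γ hγ

theorem val_bit (b : Bool) : Val (A.program d k) (.sort .bool) (bitT b) := by
  have h : HasType (S := A.sig d k) (bitT b) (.sort .bool) :=
    hasType_con.2 ⟨rfl, .nil⟩
  exact ⟨.data _ (.con _ _ h (by simp)), h⟩

theorem val_cell (c : A.C) : Val (A.program d k) (.sort .cell) (cellT c) := by
  have h : HasType (S := A.sig d k) (cellT c) (.sort .cell) :=
    hasType_con.2 ⟨rfl, .nil⟩
  exact ⟨.data _ (.con _ _ h (by simp)), h⟩

theorem isData_enc (s : List Bool) :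
    IsData (enc s : Term (A.sig d k)) ∧ HasType (enc s : Term (A.sig d k)) (.sort .list) := by
  induction s with
  | nil =>
    have h : HasType (S := A.sig d k) (enc []) (.sort .list) := hasType_con.2 ⟨rfl, .nil⟩
    exact ⟨.con _ _ h (by simp), h⟩
  | cons b s ih =>
    have h : HasType (S := A.sig d k) (enc (b :: s)) (.sort .list) :=
      hasType_con.2 ⟨rfl, .cons (val_bit b).2 (.cons ih.2 .nil)⟩
    refine ⟨.con _ _ h ?_, h⟩
    intro t ht
    simp only [List.mem_cons, List.not_mem_nil, or_false] at ht
    rcases ht with rfl | rfl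
    · exact .con _ _ (val_bit b).2 (by simp)
    · exact ih.1

theorem val_enc (s : List Bool) : Val (A.program d k) (.sort .list) (enc s) :=
  ⟨.data _ (isData_enc s).1, (isData_enc s).2⟩

section Call

variable {P : Program} {f : P.sig.Def} {s₁ s₂ s₃ s₄ s₅ : Term P.sig}
  {Φ₁ Φ₂ Φ₃ Φ₄ Φ₅ Ψ : Term P.sig → Prop}

theorem Res.call₁ (h₁ : Res P s₁ Φ₁) (h : ∀ v₁, Φ₁ v₁ → Res P (.app (.fn f) [v₁]) Ψ) :
    Res P (.app (.fn f) [s₁]) Ψ := by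
  refine Res.call (.cons h₁ .nil) fun vs _ hvs => ?_
  rcases hvs with _ | ⟨h1, _ | _⟩
  exact h _ h1

theorem Res.call₂ (h₁ : Res P s₁ Φ₁) (h₂ : Res P s₂ Φ₂)
    (h : ∀ v₁ v₂, Φ₁ v₁ → Φ₂ v₂ → Res P (.app (.fn f) [v₁, v₂]) Ψ) :
    Res P (.app (.fn f) [s₁, s₂]) Ψ := by
  refine Res.call (.cons h₁ (.cons h₂ .nil)) fun vs _ hvs => ?_
  rcases hvs with _ | ⟨h1, _ | ⟨h2, _ | _⟩⟩
  exact h _ _ h1 h2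

theorem Res.call₃ (h₁ : Res P s₁ Φ₁) (h₂ : Res P s₂ Φ₂) (h₃ : Res P s₃ Φ₃)
    (h : ∀ v₁ v₂ v₃, Φ₁ v₁ → Φ₂ v₂ → Φ₃ v₃ → Res P (.app (.fn f) [v₁, v₂, v₃]) Ψ) :
    Res P (.app (.fn f) [s₁, s₂, s₃]) Ψ := by
  refine Res.call (.cons h₁ (.cons h₂ (.cons h₃ .nil))) fun vs _ hvs => ?_
  rcases hvs with _ | ⟨h1, _ | ⟨h2, _ | ⟨h3, _ | _⟩⟩⟩
  exact h _ _ _ h1 h2 h3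

theorem Res.call₄ (h₁ : Res P s₁ Φ₁) (h₂ : Res P s₂ Φ₂) (h₃ : Res P s₃ Φ₃) (h₄ : Res P s₄ Φ₄)
    (h : ∀ v₁ v₂ v₃ v₄, Φ₁ v₁ → Φ₂ v₂ → Φ₃ v₃ → Φ₄ v₄ →
      Res P (.app (.fn f) [v₁, v₂, v₃, v₄]) Ψ) :
    Res P (.app (.fn f) [s₁, s₂, s₃, s₄]) Ψ := by
  refine Res.call (.cons h₁ (.cons h₂ (.cons h₃ (.cons h₄ .nil)))) fun vs _ hvs => ?_
  rcases hvs with _ | ⟨h1, _ | ⟨h2, _ | ⟨h3, _ | ⟨h4, _ | _⟩⟩⟩⟩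
  exact h _ _ _ _ h1 h2 h3 h4

theorem Res.call₅ (h₁ : Res P s₁ Φ₁) (h₂ : Res P s₂ Φ₂) (h₃ : Res P s₃ Φ₃) (h₄ : Res P s₄ Φ₄)
    (h₅ : Res P s₅ Φ₅)
    (h : ∀ v₁ v₂ v₃ v₄ v₅, Φ₁ v₁ → Φ₂ v₂ → Φ₃ v₃ → Φ₄ v₄ → Φ₅ v₅ →
      Res P (.app (.fn f) [v₁, v₂, v₃, v₄, v₅]) Ψ) :
    Res P (.app (.fn f) [s₁, s₂, s₃, s₄, s₅]) Ψ := by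
  refine Res.call (.cons h₁ (.cons h₂ (.cons h₃ (.cons h₄ (.cons h₅ .nil))))) fun vs _ hvs => ?_
  rcases hvs with _ | ⟨h1, _ | ⟨h2, _ | ⟨h3, _ | ⟨h4, _ | ⟨h5, _ | _⟩⟩⟩⟩⟩
  exact h _ _ _ _ _ h1 h2 h3 h4 h5

end Call

attribute [local simp] Term.subst substList env Term.vars varsList Head.vars

theorem res_op (g : Bool → Bool → Bool) (a b : Bool) :
    Res (A.program d k) (fnT (.op g) [bitT a, bitT b]) (· = bitT (g a b)) := by
  refine Res.step [] ([bitT a, bitT b], bitT (g a b)) ?_ (by simp) (by simp) (by simp)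
    (by simp [(val_bit _).1]) ?_ (Res.value (val_bit _).1 rfl)
  · simp only [body, List.mem_flatMap, List.mem_map]
    exact ⟨a, by cases a <;> simp, b, by cases b <;> simp, rfl⟩
  · intro r hr γ h
    simp only [body, List.mem_flatMap, List.mem_map] at hr
    obtain ⟨a', -, b', -, rfl⟩ := hr
    simp at h
    simp [h]

theorem res_sym (b : Bool) :
    Res (A.program d k) (fnT .sym [bitT b]) (· = cellT (A.sym b)) := by
  refine Res.step [] ([bitT b], cellT (A.sym b)) ?_ (by simp) (by simp) (by simp)
    (by simp [(val_bit _).1]) ?_ (Res.value (val_cell _).1 rfl)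
  · simp only [body, List.mem_map]
    exact ⟨b, by cases b <;> simp, rfl⟩
  · intro r hr γ h
    simp only [body, List.mem_map] at hr
    obtain ⟨b', -, rfl⟩ := hr
    simp at h
    simp [h]

theorem res_out (c : A.C) :
    Res (A.program d k) (fnT .out [cellT c]) (· = bitT (A.acc c)) := by
  refine Res.step [] ([cellT c], bitT (A.acc c)) ?_ (by simp) (by simp) (by simp)
    (by simp [(val_cell _).1]) ?_ (Res.value (val_bit _).1 rfl)
  · simp only [body, List.mem_map]
    exact ⟨c, by simp, rfl⟩
  · intro r hr γ h
    simp only [body, List.mem_map] at hr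
    obtain ⟨c', -, rfl⟩ := hr
    simp at h
    simp [h]

theorem res_loc (a b c : A.C) :
    Res (A.program d k) (fnT .loc [cellT a, cellT b, cellT c]) (· = cellT (A.loc a b c)) := by
  refine Res.step [] ([cellT a, cellT b, cellT c], cellT (A.loc a b c)) ?_ (by simp) (by simp)
    (by simp) (by simp [(val_cell _).1]) ?_ (Res.value (val_cell _).1 rfl)
  · simp only [body, List.mem_map]
    exact ⟨(a, b, c), by simp, rfl⟩
  · intro r hr γ h
    simp only [body, List.mem_map] at hr
    obtain ⟨⟨a', b', c'⟩, -, rfl⟩ := hr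
    simp at h
    simp [h]

/-! ### Evaluation of the program: counters -/

/-- The number of values of a counter of level `l`, for inputs of length `n`. -/
def counterSize (d n : ℕ) : ℕ → ℕ
  | 0 => 1
  | l + 1 => if l < d then counterSize d n l * (n + 1) else 2 ^ counterSize d n l

/-- `Repr A d k n l v m`: for inputs of length `n` the value `v` is a counter of level `l` that
represents the number `m`. A counter of a tuple level ends in a list, whose length is the last digit
of `m` in base `n + 1`; one of a functional level takes a representation of `i` to bit `i` of
`m`. -/
def Repr (A : Automaton) (d k n : ℕ) : ℕ → Term (A.sig d k) → ℕ → Prop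
  | 0, v, m => v = bitT true ∧ m = 0
  | l + 1, v, m =>
    if l < d then ∃ u s m', v = .pair u (enc s) ∧ Repr A d k n l u m' ∧ s.length ≤ n ∧
      m = m' * (n + 1) + s.length
    else Val (A.program d k) (counterTy d (l + 1)) v ∧ m < 2 ^ counterSize d n l ∧
      ∀ u i, Repr A d k n l u i → Res (A.program d k) (v.applyTo [u]) (· = bitT (m.testBit i))

variable {n : ℕ}

theorem counterSize_pos (l : ℕ) : 0 < counterSize d n l := by
  induction l with
  | zero => simp [counterSize]
  | succ l ih =>
    simp only [counterSize]
    split_ifs <;> positivity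

theorem Repr.val {l : ℕ} {v : Term (A.sig d k)} {m : ℕ} (h : Repr A d k n l v m) :
    Val (A.program d k) (counterTy d l) v := by
  induction l generalizing v m with
  | zero =>
    obtain ⟨rfl, -⟩ := h
    exact val_bit true
  | succ l ih =>
    simp only [Repr] at h
    split_ifs at h with hl
    · obtain ⟨u, s, m', rfl, hu, -, -⟩ := h
      simp only [counterTy, hl, if_true]
      exact ⟨.pair _ _ (ih hu).1 (val_enc s).1, .pair _ _ _ _ (ih hu).2 (val_enc s).2⟩
    · exact h.1

theorem Repr.lt {l : ℕ} {v : Term (A.sig d k)} {m : ℕ} (h : Repr A d k n l v m) :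
    m < counterSize d n l := by
  induction l generalizing v m with
  | zero =>
    obtain ⟨-, rfl⟩ := h
    simp [counterSize]
  | succ l ih =>
    simp only [Repr] at h
    simp only [counterSize]
    split_ifs at h ⊢ with hl
    · obtain ⟨u, s, m', rfl, hu, hs, rfl⟩ := h
      have := ih hu
      nlinarith
    · exact h.2.1

/-- The correctness of the functions of level `l` on input `x`. The predecessor of `0` is the largest
counter. -/
structure CounterSpec (A : Automaton) (d k : ℕ) (x : List Bool) (l : Fin (d + k + 1)) : Prop where
  max : Res (A.program d k) (fnT (.max l) [enc x])
    (Repr A d k x.length l · (counterSize d x.length l - 1))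
  pred : ∀ v m, Repr A d k x.length l v m → Res (A.program d k) (fnT (.pred l) [enc x, v])
    (Repr A d k x.length l · (if m = 0 then counterSize d x.length l - 1 else m - 1))
  zero : ∀ v m, Repr A d k x.length l v m → Res (A.program d k) (fnT (.zero l) [enc x, v])
    (· = bitT (decide (m = 0)))

theorem counterSpec_zero (x : List Bool) : CounterSpec A d k x 0 := by
  have hx := val_enc (A := A) (d := d) (k := k) x
  have hb := val_bit (A := A) (d := d) (k := k) true
  refine ⟨?_, ?_, ?_⟩
  · refine Res.step [enc x] ([inp], bitT true) (by simp [body, maxBody]) (by simp) (by simp)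
      (by simp [hx]) (by simp [hx.1]) (by simp [body, maxBody]) (Res.value hb.1 ?_)
    simp [Repr, counterSize]
  · rintro v m ⟨rfl, rfl⟩
    refine Res.step [enc x, bitT true] ([inp, bvar 1], bitT true) (by simp [body, predBody])
      (by simp) (by simp)
      (by simp [hx, hb]) (by simp [hx.1, hb.1]) (by simp [body, predBody]) (Res.value hb.1 ?_)
    simp [Repr, counterSize]
  · rintro v m ⟨rfl, rfl⟩
    exact Res.step [enc x, bitT true] ([inp, bvar 1], bitT true) (by simp [body, zeroBody])
      (by simp) (by simp)
      (by simp [hx, hb]) (by simp [hx.1, hb.1]) (by simp [body, zeroBody]) (Res.value hb.1 rfl)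

theorem counterSpec_pair (x : List Bool) (l : Fin (d + k)) (hl : l < d)
    (ih : CounterSpec A d k x l.castSucc) : CounterSpec A d k x l.succ := by
  have hx := val_enc (A := A) (d := d) (k := k) x
  have hb := val_bit (A := A) (d := d) (k := k)
  have hpos := counterSize_pos (d := d) (n := x.length) l
  obtain ⟨c, hc⟩ := Nat.exists_eq_succ_of_ne_zero hpos.ne'
  -- A tuple ending in the whole input: the largest counter, or the result of a borrow.
  have hlast : ∀ u m m', Repr A d k x.length l u m → m' = m * (x.length + 1) + x.length →
      Repr A d k x.length l.succ (.pair u (enc x)) m' := by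
    rintro u m _ hu rfl
    simp only [Fin.val_succ, Repr, hl, if_true]
    exact ⟨u, x, m, rfl, hu, le_rfl, rfl⟩
  refine ⟨?_, ?_, ?_⟩
  · refine Res.step [enc x] ([inp], .pair (fnT (.max l.castSucc) [inp]) inp)
      (by simp [body, maxBody, hl]) (by simp) (by simp) (by simp [hx])
      (by simp [hx.1])
      (by simp +contextual [body, maxBody, hl])
      (Res.pair ih.max (Res.self hx.1) ?_)
    rintro u v hu rfl
    refine hlast u _ _ hu ?_
    simp only [Fin.val_succ, counterSize, hl, if_true, Fin.val_castSucc, hc, Nat.succ_mul]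
    simp
  · intro v m hv
    simp only [Fin.val_succ, Repr, hl, if_true] at hv
    obtain ⟨u, s, m, rfl, hu, hs, rfl⟩ := hv
    cases s with
    | nil =>
      refine Res.step [enc x, u] ([inp, .pair (cvar 1 l) (conT .nil [])],
          .pair (fnT (.pred l.castSucc) [inp, cvar 1 l]) inp)
        (by simp [body, predBody, hl]) (by simp [enc]) (by simp) (by simp [hx, hu.val])
        (by simp [hx.1]; exact .pair _ _ hu.val.1 (val_enc []).1)
        (by simp +contextual [body, predBody, hl, enc])
        (Res.pair (ih.pred u m hu) (Res.self hx.1) ?_)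
      rintro u v hu rfl
      refine hlast u _ _ hu ?_
      simp only [Fin.val_succ, counterSize, hl, if_true, Fin.val_castSucc, hc, Nat.succ_mul]
      rcases m with _ | m
      · simp
      · simp [Nat.succ_mul]
    | cons b s =>
      refine Res.step [enc x, u, bitT b, enc s]
        ([inp, .pair (cvar 1 l) (conT .cons [bvar 2, lvar 3])], .pair (cvar 1 l) (lvar 3))
        (by simp [body, predBody, hl]) (by simp [enc]) rfl
        (by simp [hx, hu.val, hb, val_enc s])
        (by simp [hx.1]; exact .pair _ _ hu.val.1 (val_enc _).1)
        (by simp +contextual [body, predBody, hl, enc])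
        (Res.value ?_ ?_)
      · simpa using .pair _ _ hu.val.1 (val_enc s).1
      · simp only [Fin.val_succ, Repr, hl, if_true]
        refine ⟨u, s, m, by simp, hu, by simp at hs; omega, by simp⟩
  · intro v m hv
    simp only [Fin.val_succ, Repr, hl, if_true] at hv
    obtain ⟨u, s, m, rfl, hu, hs, rfl⟩ := hv
    cases s with
    | nil =>
      refine Res.step [enc x, u] ([inp, .pair (cvar 1 l) (conT .nil [])],
          fnT (.zero l.castSucc) [inp, cvar 1 l])
        (by simp [body, zeroBody, hl]) (by simp [enc]) (by simp) (by simp [hx, hu.val])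
        (by simp [hx.1]; exact .pair _ _ hu.val.1 (val_enc []).1)
        (by simp +contextual [body, zeroBody, hl, enc])
        ((ih.zero u m hu).mono ?_)
      rintro _ rfl
      simp
    | cons b s =>
      refine Res.step [enc x, u, bitT b, enc s]
        ([inp, .pair (cvar 1 l) (conT .cons [bvar 2, lvar 3])], bitT false)
        (by simp [body, zeroBody, hl]) (by simp [enc]) rfl
        (by simp [hx, hu.val, hb, val_enc s])
        (by simp [hx.1]; exact .pair _ _ hu.val.1 (val_enc _).1)
        (by simp +contextual [body, zeroBody, hl, enc])
        (Res.value (hb false).1 (by simp))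

theorem mod_two_pow_succ (m i : ℕ) :
    m % 2 ^ (i + 1) = m % 2 ^ i + 2 ^ i * (m.testBit i).toNat := by
  rw [Nat.pow_succ, Nat.mod_mul, Nat.toNat_testBit]

/-- `below` computes whether a bit with a position less than `i` is set, that is, whether the
remainder modulo `2 ^ i` is not `0`. -/
theorem res_below (x : List Bool) (l : Fin (d + k)) (hl : ¬ l < d)
    (ih : CounterSpec A d k x l.castSucc) {F : Term (A.sig d k)} {m : ℕ}
    (hF : Repr A d k x.length (l + 1) F m) (i : ℕ) (u : Term (A.sig d k))
    (hu : Repr A d k x.length l u i) :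
    Res (A.program d k) (fnT (.below l) [enc x, F, u]) (· = bitT (decide (m % 2 ^ i ≠ 0))) := by
  have hx := val_enc (A := A) (d := d) (k := k) x
  have hb := val_bit (A := A) (d := d) (k := k)
  have hFv := hF.val
  have hFa : Val (A.program d k) (.arrow (counterTy d l) (.sort .bool)) F := by
    simpa [counterTy, hl] using hFv
  have hFb : ∀ u i, Repr A d k x.length l u i →
      Res (A.program d k) (F.applyTo [u]) (· = bitT (m.testBit i)) := by
    simp only [Repr, hl, if_false] at hF
    exact hF.2.2
  induction i generalizing u with
  | zero =>
    refine Res.step [enc x, F, u] ([inp, cvar 1 (l + 1), cvar 2 l],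
      fnT (.below1 l) [inp, cvar 1 (l + 1), cvar 2 l, fnT (.zero l.castSucc) [inp, cvar 2 l]])
      (by simp [body, hl]) (by simp) (by simp; rfl) (by simp [hx, hFv, hu.val])
      (by simp [hx.1, hFv.1, hu.val.1]) (by simp +contextual [body, hl]) ?_
    refine Res.call₄ (Res.self hx.1) (Res.self hFv.1) (Res.self hu.val.1) (ih.zero u _ hu) ?_
    rintro _ _ _ _ rfl rfl rfl rfl
    exact Res.step [enc x, F, u] ([inp, cvar 1 (l + 1), cvar 2 l, bitT true], bitT false)
      (by simp [body, hl]) (by simp) rfl (by simp [hx, hFv, hu.val])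
      (by simp [hx.1, hFv.1, hu.val.1, (hb _).1]) (by simp +contextual [body, hl])
      (Res.value (hb _).1 (by simp [Nat.mod_one]))
  | succ j IH =>
    refine Res.step [enc x, F, u] ([inp, cvar 1 (l + 1), cvar 2 l],
      fnT (.below1 l) [inp, cvar 1 (l + 1), cvar 2 l, fnT (.zero l.castSucc) [inp, cvar 2 l]])
      (by simp [body, hl]) (by simp) (by simp; rfl) (by simp [hx, hFv, hu.val])
      (by simp [hx.1, hFv.1, hu.val.1]) (by simp +contextual [body, hl]) ?_
    refine Res.call₄ (Res.self hx.1) (Res.self hFv.1) (Res.self hu.val.1) (ih.zero u _ hu) ?_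
    rintro _ _ _ _ rfl rfl rfl rfl
    refine Res.step [enc x, F, u] ([inp, cvar 1 (l + 1), cvar 2 l, bitT false],
        fnT (.op (· || ·)) [varT 1 (counterTy d (l + 1)) [fnT (.pred l.castSucc) [inp, cvar 2 l]],
          fnT (.below l) [inp, cvar 1 (l + 1), fnT (.pred l.castSucc) [inp, cvar 2 l]]])
      (by simp [body, hl]) (by simp) (by simp; rfl) (by simp [hx, hFv, hu.val])
      (by simp [hx.1, hFv.1, hu.val.1, (hb _).1]) (by simp +contextual [body, hl]) ?_
    have hp := ih.pred u _ hu
    simp only [Nat.add_eq_zero_iff, one_ne_zero, and_false, if_false, Nat.add_sub_cancel] at hp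
    refine Res.call₂ (Res.apply hFa hp (fun u hu => hFb u j hu))
      (Res.call₃ (Ψ := (· = bitT (decide (m % 2 ^ j ≠ 0)))) (Res.self hx.1) (Res.self hFv.1) hp
        ?_) ?_
    · rintro _ _ u rfl rfl hu
      exact IH u hu
    · rintro _ _ rfl rfl
      refine (res_op _ _ _).mono ?_
      rintro _ rfl
      congr 2
      rw [mod_two_pow_succ]
      cases m.testBit j <;> simp

/-- Subtracting one borrows from all bits up to the lowest one that is set, and negates them. -/
theorem testBit_pred {m : ℕ} (hm : m ≠ 0) (i : ℕ) :
    (m - 1).testBit i = (decide (m % 2 ^ i ≠ 0) == m.testBit i) := by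
  have hpos := Nat.two_pow_pos i
  have hdiv := Nat.div_add_mod m (2 ^ i)
  have hlt := Nat.mod_lt m hpos
  rw [Nat.testBit_eq_decide_div_mod_eq, Nat.testBit_eq_decide_div_mod_eq]
  generalize m / 2 ^ i = q at hdiv
  generalize m % 2 ^ i = r at hdiv hlt
  generalize 2 ^ i = p at *
  by_cases hr : r = 0
  · subst hr
    obtain ⟨q, rfl⟩ : ∃ q', q = q' + 1 := Nat.exists_eq_succ_of_ne_zero (by rintro rfl; omega)
    have : (m - 1) / p = q := by
      rw [Nat.div_eq_iff hpos, ← hdiv]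
      rw [Nat.mul_succ, Nat.mul_comm q p]
      omega
    rw [this]
    rcases Nat.mod_two_eq_zero_or_one q with h | h <;> simp [Nat.add_mod, h]
  · have : (m - 1) / p = q := by
      rw [Nat.div_eq_iff hpos, ← hdiv, Nat.mul_comm q p]
      omega
    rw [this]
    simp [hr]

theorem counterSpec_fun (x : List Bool) (l : Fin (d + k)) (hl : ¬ l < d)
    (ih : CounterSpec A d k x l.castSucc) : CounterSpec A d k x l.succ := by
  have hx := val_enc (A := A) (d := d) (k := k) x
  have hb := val_bit (A := A) (d := d) (k := k)
  have hpos := counterSize_pos (d := d) (n := x.length) l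
  refine ⟨?_, ?_, ?_⟩
  · have hv : Val (A.program d k) (counterTy d (l + 1)) (fnT (.max l.succ) [enc x]) := by
      have ht : HasType (S := A.sig d k) (fnT (.max l.succ) [enc x]) (counterTy d (l + 1)) := by
        simp [hasType_fn, Fn.ty, TypedArgs, hx.2]
      refine ⟨.partialApp _ _ ?_ (by simp [hx.1]) ⟨_, ht⟩, ht⟩
      exact ⟨⟨.max l.succ, [inp, cvar 1 l], bitT true⟩,
        mem_rules.2 (by simp [body, maxBody, hl]), rfl, by simp⟩
    refine Res.value hv.1 ?_
    simp only [Fin.val_succ, Repr, hl, if_false, counterSize]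
    refine ⟨hv, by have := Nat.one_le_two_pow (n := counterSize d x.length l); omega, ?_⟩
    intro u i hu
    refine Res.step [enc x, u] ([inp, cvar 1 l], bitT true)
      (by simp [body, maxBody, hl]) (by simp) rfl (by simp [hx, hu.val])
      (by simp [hx.1, hu.val.1]) (by simp +contextual [body, maxBody, hl])
      (Res.value (hb _).1 ?_)
    rw [Nat.testBit_two_pow_sub_one]
    simp [hu.lt]
  · intro F m hF
    have hFv := hF.val
    have hF' := hF
    simp only [Fin.val_succ, Repr, hl, if_false] at hF'
    obtain ⟨-, hm, hFb⟩ := hF'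
    have hv : Val (A.program d k) (counterTy d (l + 1)) (fnT (.pred l.succ) [enc x, F]) := by
      have ht : HasType (S := A.sig d k) (fnT (.pred l.succ) [enc x, F])
          (counterTy d (l + 1)) := by
        simpa [hasType_fn, Fn.ty, TypedArgs, hx.2] using hFv.2
      refine ⟨.partialApp _ _ ?_ (by simp [hx.1, hFv.1]) ⟨_, ht⟩, ht⟩
      exact ⟨⟨.pred l.succ, [inp, cvar 1 (l + 1), cvar 2 l], _⟩,
        mem_rules.2 (by simp [body, predBody, hl]; rfl), rfl, by simp⟩
    refine Res.value hv.1 ?_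
    simp only [Fin.val_succ, Repr, hl, if_false, counterSize]
    refine ⟨hv, by split_ifs <;> omega, ?_⟩
    intro u i hu
    refine Res.step [enc x, F, u] ([inp, cvar 1 (l + 1), cvar 2 l],
          fnT (.op (· == ·)) [fnT (.below l) [inp, cvar 1 (l + 1), cvar 2 l],
            varT 1 (counterTy d (l + 1)) [cvar 2 l]])
      (by simp [body, predBody, hl]) (by simp) (by simp; rfl)
      (by simp [hx, hu.val]; simpa using hFv)
      (by simp [hx.1, hu.val.1, hFv.1]) (by simp +contextual [body, predBody, hl]) ?_
    refine Res.call₂ (res_below x l hl ih hF i u hu) (hFb u i hu) ?_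
    rintro _ _ rfl rfl
    refine (res_op _ _ _).mono ?_
    rintro _ rfl
    congr 2
    split_ifs with h0
    · -- The predecessor of `0` has all bits set, which makes it the largest counter.
      subst h0
      rw [Nat.testBit_two_pow_sub_one]
      simp [hu.lt]
    · exact (testBit_pred h0 i).symm
  · intro F m hF
    have hFv := hF.val
    have hF' := hF
    simp only [Fin.val_succ, Repr, hl, if_false] at hF'
    obtain ⟨hFa, hm, hFb⟩ := hF'
    simp only [counterTy, hl, if_false] at hFa
    refine Res.step [enc x, F] ([inp, cvar 1 (l + 1)],
          fnT (.op fun a b => !a && !b)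
            [varT 1 (counterTy d (l + 1)) [fnT (.max l.castSucc) [inp]],
              fnT (.below l) [inp, cvar 1 (l + 1), fnT (.max l.castSucc) [inp]]])
      (by simp [body, zeroBody, hl]) (by simp) (by simp; rfl) (by simp [hx]; simpa using hFv)
      (by simp [hx.1, hFv.1]) (by simp +contextual [body, zeroBody, hl]) ?_
    refine Res.call₂ (Res.apply hFa ih.max (fun u hu => hFb u _ hu))
      (Res.call₃ (Ψ := (· = bitT (decide (m % 2 ^ (counterSize d x.length l - 1) ≠ 0))))
        (Res.self hx.1) (Res.self hFv.1) ih.max ?_) ?_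
    · rintro _ _ u rfl rfl hu
      exact res_below x l hl ih hF _ u hu
    · rintro _ _ rfl rfl
      refine (res_op _ _ _).mono ?_
      rintro _ rfl
      congr 2
      simp only [Fin.val_castSucc]
      obtain ⟨c, hc⟩ := Nat.exists_eq_succ_of_ne_zero hpos.ne'
      rw [hc] at hm ⊢
      have h1 : m = m % 2 ^ c + 2 ^ c * (m.testBit c).toNat := by
        rw [← mod_two_pow_succ, Nat.mod_eq_of_lt hm]
      have h2 := Nat.two_pow_pos c
      simp only [Nat.succ_eq_add_one, Nat.add_sub_cancel]
      cases hc : m.testBit c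
      · rw [hc] at h1
        simp at h1 ⊢
        rw [← h1]
      · have : m ≠ 0 := by
          rintro rfl
          simp at hc
        simp [this]

theorem counterSpec (x : List Bool) (l : Fin (d + k + 1)) : CounterSpec A d k x l := by
  induction l using Fin.induction with
  | zero => exact counterSpec_zero x
  | succ l ih =>
    by_cases hl : l < d
    · exact counterSpec_pair x l hl ih
    · exact counterSpec_fun x l hl ih

end Run

end ConsFree

namespace ConsFree

/-! ### Evaluation of the program: the space-time diagram -/

/-- The initial row of the space-time diagram on input `x`. -/
def Automaton.initRow (A : Automaton) (x : List Bool) : ℕ → A.C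
  | 0 => A.wall
  | 1 => A.first
  | i + 2 => (x[i]?).elim A.blank A.sym

/-- The space-time diagram. The content of cell `u + 1` depends on the cells `u - 1`, `u`, `u + 1`
in the row before, where `u - 1` stands for `N - 1` if `u = 0`, as it is the result of applying the
predecessor of counters below `N` to `u`. -/
def Automaton.grid (A : Automaton) (N : ℕ) (x : List Bool) : ℕ → ℕ → A.C
  | 0, u => A.initRow x u
  | _ + 1, 0 => A.wall
  | t + 1, u + 1 => A.loc (A.grid N x t (if u = 0 then N - 1 else u - 1)) (A.grid N x t u)
      (A.grid N x t (u + 1))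

section Grid

variable {A : Automaton} {d k : ℕ}

attribute [local simp] Term.subst substList env Term.vars varsList Head.vars

section Read

variable (x : List Bool) {v : Term (A.sig d k)} {i : ℕ}

theorem res_rd (s : List Bool) (hv : Repr A d k x.length (d + k) v i) :
    Res (A.program d k) (fnT .rd [enc x, enc s, v])
      (· = cellT ((s[i]?).elim A.blank A.sym)) := by
  have hx := val_enc (A := A) (d := d) (k := k) x
  have hb := val_bit (A := A) (d := d) (k := k)
  have hc := counterSpec (A := A) (d := d) (k := k) x (Fin.last _)
  induction s generalizing v i with
  | nil =>
    exact Res.step [enc x, v] _ (.head _) (by simp [enc]) rfl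
      (by simp [hx, hv.val]) (by simp [hx.1, hv.val.1, (val_enc _).1]) (by simp [body, enc])
      (Res.value (val_cell _).1 (by simp))
  | cons b s ih =>
    have hs := val_enc (A := A) (d := d) (k := k) s
    refine Res.step (t := fnT .rd1 [enc x, bitT b, enc s, v, fnT (.zero (Fin.last _)) [enc x, v]])
      [enc x, v, bitT b, enc s] _ (.tail _ (.head _))
      (by simp [enc]) (by simp) (by simp [hx, hv.val, hb, hs])
      (by simp [hx.1, hv.val.1, (val_enc _).1]) (by simp +contextual [body, enc]) ?_
    refine Res.call₅ (Res.self hx.1) (Res.value (hb b).1 rfl) (Res.self hs.1) (Res.self hv.val.1)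
      (hc.zero v i hv) ?_
    rintro _ _ _ _ _ rfl rfl rfl rfl rfl
    cases i with
    | zero =>
      refine Res.step (t := fnT .sym [bitT b]) [enc x, v, bitT b, enc s] _ (.head _)
        (by simp) (by simp) (by simp [hx, hv.val, hb, hs])
        (by simp [hx.1, hv.val.1, hs.1, (hb _).1]) (by simp +contextual [body]) ?_
      exact (res_sym b).mono (by simp)
    | succ i =>
      refine Res.step (t := fnT .rd [enc x, enc s, fnT (.pred (Fin.last _)) [enc x, v]])
        [enc x, v, bitT b, enc s] _ (.tail _ (.head _))
        (by simp) (by simp) (by simp [hx, hv.val, hb, hs])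
        (by simp [hx.1, hv.val.1, hs.1, (hb _).1]) (by simp +contextual [body]) ?_
      refine Res.call₃ (Res.self hx.1) (Res.self hs.1) (hc.pred v _ hv) ?_
      rintro _ _ w rfl rfl hw
      simpa using ih (v := w) (i := i) (by simpa using hw)

theorem res_init (hv : Repr A d k x.length (d + k) v i) :
    Res (A.program d k) (fnT .init [enc x, v]) (· = cellT (A.initRow x i)) := by
  have hx := val_enc (A := A) (d := d) (k := k) x
  have hb := val_bit (A := A) (d := d) (k := k)
  have hc := counterSpec (A := A) (d := d) (k := k) x (Fin.last _)
  refine Res.step (t := fnT .init1 [enc x, v, fnT (.zero (Fin.last _)) [enc x, v]])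
    [enc x, v] _ (.head _) (by simp) (by simp) (by simp [hx, hv.val])
    (by simp [hx.1, hv.val.1]) (by simp +contextual [body]) ?_
  refine Res.call₃ (Res.self hx.1) (Res.self hv.val.1) (hc.zero v i hv) ?_
  rintro _ _ _ rfl rfl rfl
  cases i with
  | zero =>
    exact Res.step [enc x, v] _ (.head _) (by simp) rfl (by simp [hx, hv.val])
      (by simp [hx.1, hv.val.1, (hb _).1]) (by simp +contextual [body])
      (Res.value (val_cell _).1 rfl)
  | succ i =>
    refine Res.step (t := fnT .init2 [enc x, fnT (.pred (Fin.last _)) [enc x, v],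
        fnT (.zero (Fin.last _)) [enc x, fnT (.pred (Fin.last _)) [enc x, v]]])
      [enc x, v] _ (.tail _ (.head _)) (by simp) (by simp)
      (by simp [hx, hv.val]) (by simp [hx.1, hv.val.1, (hb _).1]) (by simp +contextual [body]) ?_
    have hp : Res (A.program d k) (fnT (.pred (Fin.last _)) [enc x, v])
        (Repr A d k x.length (d + k) · i) := by simpa using hc.pred v _ hv
    refine Res.call₃ (Res.self hx.1) hp
      (Res.call₂ (Ψ := (· = bitT (decide (i = 0)))) (Res.self hx.1) hp ?_) ?_
    · rintro _ w rfl hw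
      exact hc.zero w i hw
    rintro _ w _ rfl hw rfl
    cases i with
    | zero =>
      exact Res.step [enc x, w] _ (.head _) (by simp) rfl (by simp [hx, hw.val])
        (by simp [hx.1, hw.val.1, (hb _).1]) (by simp +contextual [body])
        (Res.value (val_cell _).1 rfl)
    | succ i =>
      refine Res.step (t := fnT .rd [enc x, enc x, fnT (.pred (Fin.last _)) [enc x, w]])
        [enc x, w] _ (.tail _ (.head _)) (by simp) (by simp)
        (by simp [hx, hw.val]) (by simp [hx.1, hw.val.1, (hb _).1]) (by simp +contextual [body]) ?_
      refine Res.call₃ (Res.self hx.1) (Res.self hx.1) (hc.pred w _ hw) ?_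
      rintro _ _ u rfl rfl hu
      exact res_rd x x (by simpa using hu)

end Read

theorem res_cell (x : List Bool) (t u : ℕ) (v w : Term (A.sig d k))
    (hv : Repr A d k x.length (d + k) v t) (hw : Repr A d k x.length (d + k) w u) :
    Res (A.program d k) (fnT .cell [enc x, v, w])
      (· = cellT (A.grid (counterSize d x.length (d + k)) x t u)) := by
  have hx := val_enc (A := A) (d := d) (k := k) x
  have hb := val_bit (A := A) (d := d) (k := k)
  have hc := counterSpec (A := A) (d := d) (k := k) x (Fin.last _)
  induction t generalizing u v w with
  | zero =>
    refine Res.step (t := fnT .cell1 [enc x, v, w, fnT (.zero (Fin.last _)) [enc x, v],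
        fnT (.zero (Fin.last _)) [enc x, w]]) [enc x, v, w] _ (.head _) (by simp) (by simp)
      (by simp [hx, hv.val, hw.val]) (by simp [hx.1, hv.val.1, hw.val.1])
      (by simp +contextual [body]) ?_
    refine Res.call₅ (Res.self hx.1) (Res.self hv.val.1) (Res.self hw.val.1) (hc.zero v _ hv)
      (hc.zero w u hw) ?_
    rintro _ _ _ _ _ rfl rfl rfl rfl rfl
    exact Res.step (t := fnT .init [enc x, w]) [enc x, v, w, bitT (decide (u = 0))] _ (.head _)
      (by simp) (by simp) (by simp [hx, hv.val, hw.val, hb])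
      (by simp [hx.1, hv.val.1, hw.val.1, (hb _).1]) (by simp +contextual [body])
      (res_init x hw)
  | succ t ih =>
    refine Res.step (t := fnT .cell1 [enc x, v, w, fnT (.zero (Fin.last _)) [enc x, v],
        fnT (.zero (Fin.last _)) [enc x, w]]) [enc x, v, w] _ (.head _) (by simp) (by simp)
      (by simp [hx, hv.val, hw.val]) (by simp [hx.1, hv.val.1, hw.val.1])
      (by simp +contextual [body]) ?_
    refine Res.call₅ (Res.self hx.1) (Res.self hv.val.1) (Res.self hw.val.1) (hc.zero v _ hv)
      (hc.zero w u hw) ?_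
    rintro _ _ _ _ _ rfl rfl rfl rfl rfl
    cases u with
    | zero =>
      exact Res.step [enc x, v, w] _ (.tail _ (.head _))
        (by simp) rfl (by simp [hx, hv.val, hw.val])
        (by simp [hx.1, hv.val.1, hw.val.1, (hb _).1]) (by simp +contextual [body])
        (Res.value (val_cell _).1 rfl)
    | succ u =>
      refine Res.step (t := fnT .loc
          [fnT .cell [enc x, fnT (.pred (Fin.last _)) [enc x, v],
            fnT (.pred (Fin.last _)) [enc x, fnT (.pred (Fin.last _)) [enc x, w]]],
          fnT .cell [enc x, fnT (.pred (Fin.last _)) [enc x, v],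
            fnT (.pred (Fin.last _)) [enc x, w]],
          fnT .cell [enc x, fnT (.pred (Fin.last _)) [enc x, v], w]])
        [enc x, v, w] _ (.tail _ (.tail _ (.head _)))
        (by simp) (by simp) (by simp [hx, hv.val, hw.val])
        (by simp [hx.1, hv.val.1, hw.val.1, (hb _).1]) (by simp +contextual [body]) ?_
      have hpv : Res (A.program d k) (fnT (.pred (Fin.last _)) [enc x, v])
          (Repr A d k x.length (d + k) · t) := by simpa using hc.pred v _ hv
      have hpw : Res (A.program d k) (fnT (.pred (Fin.last _)) [enc x, w])
          (Repr A d k x.length (d + k) · u) := by simpa using hc.pred w _ hw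
      have hcell : ∀ (s : Term (A.sig d k)) (i : ℕ),
          Res (A.program d k) s (Repr A d k x.length (d + k) · i) →
          Res (A.program d k) (fnT .cell [enc x, fnT (.pred (Fin.last _)) [enc x, v], s])
            (· = cellT (A.grid (counterSize d x.length (d + k)) x t i)) := by
        intro s i hs
        refine Res.call₃ (Res.self hx.1) hpv hs ?_
        rintro _ v' w' rfl hv' hw'
        exact ih i v' w' hv' hw'
      refine Res.call₃ (hcell _ (if u = 0 then counterSize d x.length (d + k) - 1 else u - 1) ?_)
        (hcell _ _ hpw) (hcell _ _ (Res.value hw.val.1 hw)) ?_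
      · refine Res.call₂ (Res.self hx.1) hpw ?_
        rintro _ w' rfl hw'
        exact hc.pred w' u hw'
      · rintro _ _ _ rfl rfl rfl
        exact res_loc _ _ _

/-- The program answers whether the last cell of the diagonal is accepting. -/
theorem res_start (x : List Bool) :
    Res (A.program d k) (fnT .start [enc x])
      (· = bitT (A.acc (A.grid (counterSize d x.length (d + k)) x
        (counterSize d x.length (d + k) - 1) (counterSize d x.length (d + k) - 1)))) := by
  have hx := val_enc (A := A) (d := d) (k := k) x
  have hc := counterSpec (A := A) (d := d) (k := k) x (Fin.last _)
  refine Res.step (t := fnT .out [fnT .cell [enc x, fnT (.max (Fin.last _)) [enc x],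
      fnT (.max (Fin.last _)) [enc x]]]) [enc x] _ (.head _) (by simp) (by simp) (by simp [hx])
    (by simp [hx.1]) (by simp +contextual [body]) ?_
  refine Res.call₁ (Res.call₃ (Ψ := (· = cellT (A.grid (counterSize d x.length (d + k)) x
      (counterSize d x.length (d + k) - 1) (counterSize d x.length (d + k) - 1))))
    (Res.self hx.1) hc.max hc.max ?_) ?_
  · rintro _ v w rfl hv hw
    exact res_cell x _ _ v w hv hw
  · rintro _ rfl
    exact res_out _

variable (A d k)

/-- The symbols for input and output. -/
def Automaton.interface : (A.program d k).Interface where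
  boolSort := Srt.bool
  listSort := Srt.list
  sorts_ne := by simp
  tt := Con.bool true
  ff := Con.bool false
  tt_ne_ff := by simp
  nil := Con.nil
  cons := Con.cons
  start := Fn.start
  tt_ty := ⟨rfl, rfl⟩
  ff_ty := ⟨rfl, rfl⟩
  nil_ty := ⟨rfl, rfl⟩
  cons_ty := ⟨rfl, rfl⟩
  start_ty := rfl

theorem interface_bit (b : Bool) : (A.interface d k).bit b = bitT b := by
  cases b <;> rfl

theorem interface_encode (x : List Bool) : (A.interface d k).encode x = enc x := by
  induction x with
  | nil => rfl
  | cons b x ih => rw [Program.Interface.encode, ih, interface_bit]; rfl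

variable {A d k}

theorem program_accepts {L : Set Word}
    (h : ∀ x : Word, A.acc (A.grid (counterSize d x.1.length (d + k)) x.1
      (counterSize d x.1.length (d + k) - 1) (counterSize d x.1.length (d + k) - 1)) = true ↔
        x ∈ L) : (A.program d k).Accepts L := by
  refine ⟨A.interface d k, fun x => ?_⟩
  rw [interface_bit, interface_encode, ← h x]
  obtain ⟨⟨w, hw⟩, huniq⟩ := res_start (A := A) (d := d) (k := k) x.1
  constructor
  · intro hacc
    have := (huniq w hw).2
    rw [hacc] at this
    exact this ▸ hw
  · intro ht
    have := (huniq _ ht).2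
    simpa using this.symm

end Grid

end ConsFree

namespace ConsFree

/-! ### Turing machines as cellular automata -/

namespace TM

variable (M : TM)

attribute [local instance] TM.finQ TM.finΓ

open Classical in
/-- The transition function, extended to the final states: a final configuration is repeated. -/
noncomputable def trans (q : M.Q) (g : M.Γ) : M.Q × M.Γ × Move :=
  if q = M.accept ∨ q = M.reject then (q, g, .stay) else M.δ q g

theorem step_eq (c : M.Cfg) : M.step c =
    { state := (M.trans c.state (c.tape c.head)).1
      head := (M.trans c.state (c.tape c.head)).2.2.apply c.head
      tape := Function.update c.tape c.head (M.trans c.state (c.tape c.head)).2.1 } := by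
  unfold step trans
  split_ifs <;> simp [Move.apply]

/-- The contents of the cells of the automaton: `none` for the cells to the left of the tape,
otherwise a tape symbol, together with the state of the machine if the head is there. -/
abbrev Cell : Type := Option (M.Γ × Option M.Q)

open Classical in
/-- The head is in the cell, in the accepting state. -/
noncomputable def isAcc : M.Cell → Bool
  | some (_, some q) => decide (q = M.accept)
  | _ => false

open Classical in
/-- The new state, if the head is in the cell and makes the move `m`. -/
noncomputable def leave (m : Move) : M.Cell → Option M.Q
  | some (g, some q) => if (M.trans q g).2.2 = m then some (M.trans q g).1 else none
  | _ => none

/-- The symbol that replaces the one in the cell. -/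
noncomputable def write : M.Γ × Option M.Q → M.Γ
  | (g, some q) => (M.trans q g).2.1
  | (g, none) => g

open Classical in
/-- The new state in the cell `b` with neighbours `a` and `c`, if the head arrives or remains
there. On the leftmost cell the head remains also when it should move to the left. -/
noncomputable def arrive (a b c : M.Cell) : Option M.Q :=
  (M.leave .right a).or ((M.leave .left c).or ((M.leave .stay b).or
    (if a = none then M.leave .left b else none)))

/-- The local rule. An accepting cell makes its neighbours accepting in the next row. -/
noncomputable def localRule (a b c : M.Cell) : M.Cell :=
  if M.isAcc a || M.isAcc b || M.isAcc c then some (M.blank, some M.accept)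
  else b.map fun s => (M.write s, M.arrive a b c)

/-- The cellular automaton of a machine. -/
noncomputable def automaton : Automaton where
  C := M.Cell
  fintypeC := Fintype.ofFinite _
  wall := none
  first := some (M.blank, some M.start)
  blank := some (M.blank, none)
  sym b := some (M.bit b, none)
  loc := M.localRule
  acc := M.isAcc

/-- The content of the automaton cell for position `p` of the tape. -/
def content (c : M.Cfg) (p : ℕ) : M.Cell :=
  some (c.tape p, if c.head = p then some c.state else none)

open Classical in
theorem leave_content (c : M.Cfg) (p : ℕ) (m : Move) :
    M.leave m (M.content c p) =
      if c.head = p ∧ (M.trans c.state (c.tape c.head)).2.2 = m then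
        some (M.trans c.state (c.tape c.head)).1 else none := by
  by_cases h : c.head = p
  · subst h
    simp [leave, content]
  · simp [leave, content, h]

/-- Where no cell is accepting, the local rule performs a step of the machine. -/
theorem localRule_content (c : M.Cfg) (p : ℕ) (a : M.Cell)
    (ha : a = if p = 0 then none else M.content c (p - 1))
    (hacc : (M.isAcc a || M.isAcc (M.content c p) || M.isAcc (M.content c (p + 1))) = false) :
    M.localRule a (M.content c p) (M.content c (p + 1)) = M.content (M.step c) p := by
  have hw : M.write (c.tape p, if c.head = p then some c.state else none) =
      (M.step c).tape p := by
    rw [step_eq]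
    by_cases h : c.head = p
    · subst h
      simp [write]
    · simp [write, h, Function.update_of_ne (Ne.symm h)]
  have harr : M.arrive a (M.content c p) (M.content c (p + 1)) =
      if (M.step c).head = p then some (M.step c).state else none := by
    rw [step_eq]
    simp only [arrive, leave_content]
    subst ha
    rcases Nat.eq_zero_or_pos p with rfl | hp
    · rw [if_pos rfl]
      rcases hm : (M.trans c.state (c.tape c.head)).2.2 <;> rcases hh : c.head with _ | _ | h <;>
        simp [leave, Move.apply]
    · obtain ⟨p, rfl⟩ := Nat.exists_eq_succ_of_ne_zero hp.ne'
      rw [if_neg (Nat.succ_ne_zero p), leave_content]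
      have hb : ¬ M.content c (p.succ - 1) = none := by simp [content]
      rw [if_neg hb, Option.or_none]
      generalize M.trans c.state (c.tape c.head) = r
      obtain ⟨q, g, m⟩ := r
      generalize c.head = h
      simp only [Nat.succ_eq_add_one, Nat.add_sub_cancel]
      cases m
      · by_cases h1 : h = p + 1 + 1
        · simp [h1, Move.apply]
        · simp [h1, Move.apply, show ¬ h - 1 = p + 1 by omega]
      · by_cases h1 : h = p + 1
        · simp [h1, Move.apply]
        · simp [h1, Move.apply]
      · by_cases h1 : h = p
        · simp [h1, Move.apply]
        · simp [h1, Move.apply]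
  unfold localRule
  rw [hacc]
  simp only [Bool.false_eq_true, if_false]
  rw [harr]
  simp only [content, Option.map_some, hw]

/-- The configuration after `t` steps. -/
noncomputable def conf (x : List Bool) (t : ℕ) : M.Cfg := M.step^[t] (M.init x)

theorem conf_succ (x : List Bool) (t : ℕ) : M.conf x (t + 1) = M.step (M.conf x t) :=
  Function.iterate_succ_apply' _ _ _

/-- What cell `u` of row `t` should contain: the content of position `u - t - 1`, and `none` to the
left of the tape. -/
noncomputable def cellAt (x : List Bool) (t u : ℕ) : M.Cell :=
  if u ≤ t then none else M.content (M.conf x t) (u - t - 1)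

theorem isAcc_content {c : M.Cfg} {p : ℕ} (h : M.isAcc (M.content c p) = true) :
    c.state = M.accept := by
  by_cases hp : c.head = p <;> simp_all [isAcc, content]

theorem isAcc_cellAt {x : List Bool} {t u : ℕ} (h : M.isAcc (M.cellAt x t u) = true) :
    (M.conf x t).state = M.accept := by
  unfold cellAt at h
  split_ifs at h
  · simp [isAcc] at h
  · exact M.isAcc_content h

/-- Each cell of the space-time diagram shows the tape of the machine, unless it has been made
accepting by a cell in which the machine accepts. -/
theorem grid_eq_or (N : ℕ) (x : List Bool) (t u : ℕ) :
    M.automaton.grid N x t u = M.cellAt x t u ∨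
      M.isAcc (M.automaton.grid N x t u) = true ∧ ∃ s, (M.conf x s).state = M.accept := by
  induction t generalizing u with
  | zero =>
    left
    rcases u with _ | _ | i
    · rfl
    · simp [Automaton.grid, Automaton.initRow, automaton, cellAt, content, conf, init]
    · simp only [Automaton.grid, Automaton.initRow, automaton, cellAt, content, conf, init]
      cases h : x[i]? <;> simp [h]
  | succ t ih =>
    cases u with
    | zero => exact .inl (by simp [Automaton.grid, automaton, cellAt])
    | succ u =>
      have hex : ∀ i, M.isAcc (M.automaton.grid N x t i) = true →
          ∃ s, (M.conf x s).state = M.accept := by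
        intro i hi
        rcases ih i with h | h
        · exact ⟨t, M.isAcc_cellAt (h ▸ hi)⟩
        · exact h.2
      have heq : ∀ i, M.isAcc (M.automaton.grid N x t i) = false →
          M.automaton.grid N x t i = M.cellAt x t i := by
        intro i hi
        rcases ih i with h | h
        · exact h
        · simp [hi] at h
      have hgrid : M.automaton.grid N x (t + 1) (u + 1) =
        M.localRule (M.automaton.grid N x t (if u = 0 then N - 1 else u - 1))
          (M.automaton.grid N x t u) (M.automaton.grid N x t (u + 1)) := rfl
      rw [hgrid]
      generalize hi : (if u = 0 then N - 1 else u - 1) = i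
      by_cases hacc : (M.isAcc (M.automaton.grid N x t i) || M.isAcc (M.automaton.grid N x t u) ||
          M.isAcc (M.automaton.grid N x t (u + 1))) = true
      · right
        refine ⟨?_, ?_⟩
        · unfold localRule
          rw [if_pos hacc]
          simp [isAcc]
        · simp only [Bool.or_eq_true] at hacc
          rcases hacc with (h | h) | h <;> exact hex _ h
      · left
        rw [Bool.not_eq_true] at hacc
        have hacc' := hacc
        simp only [Bool.or_eq_false_iff] at hacc'
        rw [heq _ hacc'.1.1, heq _ hacc'.1.2, heq _ hacc'.2] at hacc ⊢
        by_cases hu : u ≤ t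
        · have hb : M.cellAt x t u = none := by simp [cellAt, hu]
          rw [hb] at hacc ⊢
          unfold localRule
          rw [hacc]
          simp [cellAt, hu]
          rfl
        · obtain ⟨p, rfl⟩ : ∃ p, u = t + 1 + p := ⟨u - t - 1, by omega⟩
          have h1 : M.cellAt x t (t + 1 + p) = M.content (M.conf x t) p := by
            rw [cellAt, if_neg (by omega)]
            congr 1
            omega
          have h2 : M.cellAt x t (t + 1 + p + 1) = M.content (M.conf x t) (p + 1) := by
            rw [cellAt, if_neg (by omega)]
            congr 1
            omega
          have h3 : M.cellAt x (t + 1) (t + 1 + p + 1) = M.content (M.conf x (t + 1)) p := by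
            rw [cellAt, if_neg (by omega)]
            congr 1
            omega
          rw [h1, h2] at hacc ⊢
          rw [h3, conf_succ]
          refine M.localRule_content _ p _ ?_ hacc
          rw [if_neg (by omega)] at hi
          subst hi
          rw [cellAt]
          by_cases hp : p = 0
          · rw [if_pos hp, if_pos (by omega)]
          · rw [if_neg hp, if_neg (by omega)]
            congr 1
            omega

/-- An accepting cell `u` makes the cells `u, …, u + 2 * s` accepting after `s` rows, since the cell
for a fixed position moves on by one in each row. -/
theorem isAcc_spread {N : ℕ} {x : List Bool} {t u : ℕ} (hu : u ≠ 0)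
    (h : M.isAcc (M.automaton.grid N x t u) = true) (s e : ℕ) (he : e ≤ 2 * s) :
    M.isAcc (M.automaton.grid N x (t + s) (u + e)) = true := by
  have hgrid : ∀ t u, M.automaton.grid N x (t + 1) (u + 1) =
    M.localRule (M.automaton.grid N x t (if u = 0 then N - 1 else u - 1))
      (M.automaton.grid N x t u) (M.automaton.grid N x t (u + 1)) := fun _ _ => rfl
  obtain ⟨u, rfl⟩ := Nat.exists_eq_succ_of_ne_zero hu
  induction s generalizing e with
  | zero =>
    obtain rfl : e = 0 := by omega
    exact h
  | succ s ih =>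
    have hstep : M.isAcc (M.automaton.grid N x (t + s + 1) (u + e + 1)) = true := by
      rw [hgrid]
      unfold localRule
      rw [if_pos]
      · simp [isAcc]
      · simp only [Bool.or_eq_true]
        rcases e with _ | _ | e
        · exact .inr (ih 0 (by omega))
        · exact .inl (.inr (ih 0 (by omega)))
        · left
          left
          rw [if_neg (by omega)]
          have := ih e (by omega)
          rwa [show u.succ + e = u + (e + 1 + 1) - 1 by omega] at this
    rw [show u.succ + e = u + e + 1 by omega, ← Nat.add_assoc]
    exact hstep

theorem conf_final {x : List Bool} {s : ℕ}
    (h : (M.conf x s).state = M.accept ∨ (M.conf x s).state = M.reject) (r : ℕ) :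
    M.conf x (s + r) = M.conf x s := by
  induction r with
  | zero => rfl
  | succ r ih =>
    rw [← Nat.add_assoc, conf_succ, ih, step, if_pos h]

theorem head_conf_le (x : List Bool) (t : ℕ) : (M.conf x t).head ≤ t := by
  induction t with
  | zero => exact le_rfl
  | succ t ih =>
    rw [conf_succ, step_eq]
    cases h : (M.trans (M.conf x t).state ((M.conf x t).tape (M.conf x t).head)).2.2 <;>
      simp only [Move.apply] <;> omega

/-- The last cell of the diagonal tells whether the machine accepts: it lies to the left of the tape,
but within reach of any cell in which the machine accepts. -/
theorem acc_grid_iff {L : Set Word} {T : ℕ → ℕ} (hM : M.DecidesInTime L T) (x : Word) {N : ℕ}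
    (hN : 2 * T x.1.length + 2 ≤ N) :
    M.automaton.acc (M.automaton.grid N x.1 (N - 1) (N - 1)) = true ↔ x ∈ L := by
  change M.isAcc (M.automaton.grid N x.1 (N - 1) (N - 1)) = true ↔ x ∈ L
  obtain ⟨t, ht, hyes, hno⟩ := hM x
  change x ∈ L → (M.conf x.1 t).state = M.accept at hyes
  change x ∉ L → (M.conf x.1 t).state = M.reject at hno
  constructor
  · intro h
    by_contra hx
    obtain ⟨s, hs⟩ : ∃ s, (M.conf x.1 s).state = M.accept := by
      rcases M.grid_eq_or N x.1 (N - 1) (N - 1) with h' | h'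
      · rw [h', cellAt, if_pos le_rfl] at h
        simp [isAcc] at h
      · exact h'.2
    have h1 := M.conf_final (.inl hs) t
    have h2 := M.conf_final (.inr (hno hx)) s
    rw [Nat.add_comm, h2] at h1
    apply M.accept_ne_reject
    rw [← hs, ← h1, hno hx]
  · intro hx
    have hhead := M.head_conf_le x.1 t
    have hacc : M.isAcc (M.automaton.grid N x.1 t (t + 1 + (M.conf x.1 t).head)) = true := by
      rcases M.grid_eq_or N x.1 t (t + 1 + (M.conf x.1 t).head) with h | h
      · rw [h, cellAt, if_neg (by omega)]
        have : t + 1 + (M.conf x.1 t).head - t - 1 = (M.conf x.1 t).head := by omega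
        simp [this, content, isAcc, hyes hx]
      · exact h.1
    have := M.isAcc_spread (by omega) hacc (N - 1 - t)
      (N - 1 - (t + 1 + (M.conf x.1 t).head)) (by omega)
    rwa [show t + (N - 1 - t) = N - 1 by omega,
      show t + 1 + (M.conf x.1 t).head + (N - 1 - (t + 1 + (M.conf x.1 t).head)) = N - 1 by
        omega] at this

end TM

/-! ### The range of the counters -/

theorem counterSize_tuple {d n l : ℕ} (h : l ≤ d) : counterSize d n l = (n + 1) ^ l := by
  induction l with
  | zero => rfl
  | succ l ih => rw [counterSize, if_pos (by omega), ih (by omega), pow_succ]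

theorem counterSize_eq (d k n : ℕ) : counterSize d n (d + k) = exp2 k ((n + 1) ^ d) := by
  induction k with
  | zero => exact counterSize_tuple le_rfl
  | succ k ih => rw [← Nat.add_assoc, counterSize, if_neg (by omega), ih, exp2]

theorem exp2_mono (k : ℕ) : Monotone (exp2 k) := by
  induction k with
  | zero => exact monotone_id
  | succ k ih => exact fun _ _ h => Nat.pow_le_pow_right two_pos (ih h)

theorem two_mul_exp2_add_two_le (k m : ℕ) : 2 * exp2 k m + 2 ≤ exp2 k (2 * m + 2) := by
  induction k with
  | zero => exact le_rfl
  | succ k ih =>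
    have h1 : 2 ^ (2 * exp2 k m + 2) ≤ 2 ^ exp2 k (2 * m + 2) := Nat.pow_le_pow_right two_pos ih
    have h2 : 1 ≤ 2 ^ exp2 k m := Nat.one_le_two_pow
    have h3 : 2 ^ (2 * exp2 k m + 2) = 4 * (2 ^ exp2 k m * 2 ^ exp2 k m) := by
      rw [pow_add, two_mul, pow_add]
      ring
    simp only [exp2]
    nlinarith

/-- Tuples of suffixes of a nonempty input suffice to count beyond a given polynomial. -/
theorem polynomial_le_pow (a b : ℕ) {n : ℕ} (hn : 1 ≤ n) :
    2 * (a * n ^ b) + 2 ≤ (n + 1) ^ (b + (2 * a + 2)) := by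
  have h1 : n ^ b ≤ (n + 1) ^ b := Nat.pow_le_pow_left (by omega) b
  have h2 : 1 ≤ (n + 1) ^ b := Nat.one_le_pow _ _ (by omega)
  have h3 : 2 * a + 2 ≤ 2 ^ (2 * a + 2) := Nat.lt_two_pow_self.le
  have h4 : 2 ^ (2 * a + 2) ≤ (n + 1) ^ (2 * a + 2) := Nat.pow_le_pow_left (by omega) _
  rw [pow_add]
  calc 2 * (a * n ^ b) + 2 ≤ 2 * (a * (n + 1) ^ b) + 2 * (n + 1) ^ b := by
        have := Nat.mul_le_mul_left a h1
        omega
    _ = (n + 1) ^ b * (2 * a + 2) := by ring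
    _ ≤ (n + 1) ^ b * (n + 1) ^ (2 * a + 2) := Nat.mul_le_mul_left _ (h3.trans h4)

end ConsFree

theorem mainTheorem2 (k : ℕ) (A : Set ConsFree.Word) (hA : A ∈ ConsFree.EXPTIME k) :
    ∃ P : ConsFree.Program,
      P.IsConsFree ∧ P.UnaryVariables ∧ P.dataOrder = k ∧ P.Accepts A := by
  obtain ⟨M, T, a, b, hM, hT⟩ := hA
  refine ⟨M.automaton.program (b + (2 * a + 2)) k, ConsFree.program_isConsFree,
    ConsFree.program_unaryVariables, ConsFree.program_dataOrder,
    ConsFree.program_accepts fun x => ?_⟩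
  refine M.acc_grid_iff hM x ?_
  have hx : 1 ≤ x.1.length := List.length_pos_iff.2 x.2
  rw [ConsFree.counterSize_eq]
  calc 2 * T x.1.length + 2 ≤ 2 * ConsFree.exp2 k (a * x.1.length ^ b) + 2 := by
        have := hT x.1.length
        omega
    _ ≤ ConsFree.exp2 k (2 * (a * x.1.length ^ b) + 2) := ConsFree.two_mul_exp2_add_two_le _ _
    _ ≤ _ := ConsFree.exp2_mono k (ConsFree.polynomial_le_pow a b hx)
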